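/- Let $\mathcal M=(S,A,T,\Sigma,L)$ be a finite Markov decision process (MDP) with initial state $s_0$, where $T(s,a)$ is a probability distribution on $S$ for every action $a$ available in $s$, and $L:S\times A\times S\to\Sigma$ labels transitions. Let $\mathcal A=\langle\Sigma,Q,q_0,\Delta,\Gamma\rangle$ be a nondeterministic Büchi automaton with finite $Q$, transitions $\Delta\subseteq Q\times\Sigma\times Q$ and accepting transitions $\Gamma\subseteq Q\times\Sigma\times Q$. The product $\mathcal M\times\mathcal A$ is the MDP with states $S\times Q$, initial state $(s_0,q_0)$ and actions $A\times Q$, in which $(a,q')$ leads from $(s,q)$ to $(s',q')$ with probability $T(s,a)(s')$ if $(q,L(s,a,s'),q')\in\Delta$ and with probability $0$ otherwise, and to states with another automaton component with probability $0$; the action $(a,q')$ is available in $(s,q)$ iff this is a probability distribution. A transition $((s,q),(a,q'),(s',q'))$ is accepting iff $(q,L(s,a,s'),q')\in\Gamma$ and $T(s,a)(s')>0$. In a state without available actions the computation stops. A strategy maps each finite run whose last state has an available action to a probability distribution on the actions available there. The Büchi objective is that some accepting transition is taken infinitely often. For $\zeta\in(0,1)$, let $\mathcal M^\zeta$ be obtained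 from $\mathcal M\times\mathcal A$ by adding a state $t$ where the computation stops, making $t$ a destination of each accepting transition with probability $1-\zeta$, and multiplying the original probabilities of accepting transitions by $\zeta$ (so from $x$ under $b$, $t$ is reached with probability $(1-\zeta)$ times the total probability of the accepting transitions from $x$ under $b$). Let $\overline{\mathcal M}^\zeta$ be the same MDP equipped with rewards: every accepting transition taken earns reward $1$, whether it leads to $t$ or stays in the product. For a strategy $f$, let $\mathrm{Reach}^\zeta(f)$ be the probability of reaching $t$ in $\mathcal M^\zeta$, let $\mathrm{ETotal}^\zeta(f)\in[0,\infty]$ be the expected total (undiscounted) reward in $\overline{\mathcal M}^\zeta$, and let $\mathrm{PSat}(f)$ be the probability of the Büchi objective in $\mathcal M\times\mathcal A$, all from the initial state $(s_0,q_0)$. Then: (1) For every $\zeta\in(0,1)$, $\overline{\mathcal M}^\zeta$, $\mathcal M^\zeta$ and $\mathcal M\times\mathcal A$ have the same strategies: $\overline{\mathcal M}^\zeta$ and $\mathcal M^\zeta$ have the same underlying MDP, and restricting a strategy of $\mathcal M^\zeta$ to the finite runs of $\mathcal M\times\mathcal A$ is a bijection onto the strategies of $\mathcal M\times\mathcal A$.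 (In (2)-(5) strategies are identified in this way.) (2) For every $\zeta\in(0,1)$ and every strategy $f$, $\mathrm{Reach}^\zeta(f)=(1-\zeta)\,\mathrm{ETotal}^\zeta(f)$. (3) For every $\zeta\in(0,1)$ and every strategy $f$, $\mathrm{ETotal}^\zeta(f)\in\bigl[0,\tfrac1{1-\zeta}\bigr]$. (4) For every $\zeta\in(0,1)$ and every strategy $f$, $\mathrm{PSat}(f)=1$ if and only if $\mathrm{ETotal}^\zeta(f)=\tfrac1{1-\zeta}$. (5) There is $\zeta_0\in(0,1)$ such that for all $\zeta\in[\zeta_0,1)$ every strategy $f$ with $\mathrm{ETotal}^\zeta(f)=\sup_g\mathrm{ETotal}^\zeta(g)$ satisfies $\mathrm{PSat}(f)=\sup_g\mathrm{PSat}(g)$. -/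

import Mathlib

open MeasureTheory ProbabilityTheory
open scoped ENNReal

/-! ### Markov decision processes, finite runs, strategies -/

/-- A Markov decision process with states `S` and actions `A`. The transition function is partial:
an action `a` is available in `s` if and only if `T s a` is defined, and then `T s a` is a
probability distribution on the states. A state without available actions is a point where the
computation stops. -/
structure MDP (S A : Type*) where
  T : S → A → Option (PMF S)

/-- One entry of a run: the action by which the state was entered, and the state. The action is
`none` for the initial entry and for the repetition of a state in which the computation has
stopped. -/
def RunEntry (A S : Type*) := Option A × S

instance (A S : Type*) : MeasurableSpace (RunEntry A S) := ⊤

instance (A S : Type*) : DiscreteMeasurableSpace (RunEntry A S) := ⟨fun _ => trivial⟩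

instance (A S : Type*) [Countable A] [Countable S] : Countable (RunEntry A S) :=
  inferInstanceAs (Countable (Option A × S))

/-- The last state of the sequence with first state `s` and the given (action, state) steps. -/
def lastState {S A : Type*} (s : S) : List (A × S) → S
  | [] => s
  | (_, s') :: l => lastState s' l

namespace MDP

variable {S A : Type*} (D : MDP S A)

/-- The set `A(s)` of actions available in `s`. -/
def avail (s : S) : Set A := {a | (D.T s a).isSome}

/-- `Pr(s' | s, a)`; it is `0` if `a` is not available in `s`. -/
noncomputable def prob (s : S) (a : A) (s' : S) : ℝ≥0∞ := (D.T s a).elim 0 (fun p => p s')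

/-- Every step of the sequence has positive probability. -/
def IsPath (s : S) : List (A × S) → Prop
  | [] => True
  | (a, s') :: l => 0 < D.prob s a s' ∧ IsPath s' l

/-- Finite runs `s₀, a₁, s₁, …, aₙ, sₙ`, from any state `s₀`. -/
structure FRun where
  first : S
  steps : List (A × S)
  isPath : D.IsPath first steps

/-- The last state of a finite run. -/
def FRun.last {D : MDP S A} (r : D.FRun) : S := lastState r.first r.steps

/-- The finite runs after which a decision has to be made: those in whose last state
the computation does not stop. -/
def DecisionRun : Type _ := {r : D.FRun // (D.avail r.last).Nonempty}

/-- (History dependent, randomised) strategies. They are left undefined where the computation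
stops. -/
structure Strategy where
  choose : D.DecisionRun → PMF A
  support_subset : ∀ r : D.DecisionRun, (choose r).support ⊆ D.avail r.1.last

variable {D}

/-- The distribution of the next entry of a run after the finite run `r`: the strategy draws an
action `a`, then the MDP draws a state. (The case `none` has probability `0`.) -/
noncomputable def Strategy.next (f : D.Strategy) (r : D.DecisionRun) : PMF (RunEntry A S) :=
  (f.choose r).bind fun a =>
    match D.T r.1.last a with
    | some p => p.map fun s' => ((some a, s') : RunEntry A S)
    | none => PMF.pure ((none, r.1.last) : RunEntry A S)

/-- First state of a history of entries `0, …, n`. -/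
def histFirst {n : ℕ} (x : (i : Finset.Iic n) → RunEntry A S) : S :=
  (x ⟨0, by simp⟩).2

/-- Steps of a history of entries `0, …, n`, repetitions of a stopping state left out. -/
def histSteps {n : ℕ} (x : (i : Finset.Iic n) → RunEntry A S) : List (A × S) :=
  (List.finRange n).filterMap fun i =>
    (x ⟨i.1 + 1, Finset.mem_Iic.2 i.2⟩).1.map fun a =>
      (a, (x ⟨i.1 + 1, Finset.mem_Iic.2 i.2⟩).2)

open Classical in
/-- The law of entry `n + 1` of a run, given the entries `0, …, n`: governed by the strategy
if a decision has to be made, and a repetition of the last state if the computation has stopped. -/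
noncomputable def Strategy.stepLaw (f : D.Strategy) (n : ℕ)
    (x : (i : Finset.Iic n) → RunEntry A S) : PMF (RunEntry A S) :=
  if h : ∃ hp : D.IsPath (histFirst x) (histSteps x),
      (D.avail (FRun.last ⟨histFirst x, histSteps x, hp⟩)).Nonempty
  then f.next ⟨⟨histFirst x, histSteps x, h.1⟩, h.2⟩
  else PMF.pure ((none, (x ⟨n, by simp⟩).2) : RunEntry A S)

/-- `stepLaw` as a Markov kernel. -/
noncomputable def Strategy.stepKernel [Countable S] [Countable A] (f : D.Strategy) (n : ℕ) :
    Kernel ((i : Finset.Iic n) → RunEntry A S) (RunEntry A S) :=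
  Kernel.ofFunOfCountable fun x => (f.stepLaw n x).toMeasure

instance [Countable S] [Countable A] (f : D.Strategy) (n : ℕ) : IsMarkovKernel (f.stepKernel n) :=
  ⟨fun x => by
    change IsProbabilityMeasure (f.stepLaw n x).toMeasure
    infer_instance⟩

/-- The probability measure on the runs from state `s` under the strategy `f`
(Ionescu-Tulcea). -/
noncomputable def Strategy.runLaw [Countable S] [Countable A] (f : D.Strategy) (s : S) :
    Measure (ℕ → RunEntry A S) :=
  Kernel.trajMeasure (X := fun _ => RunEntry A S)
    (Measure.dirac ((none, s) : RunEntry A S)) f.stepKernel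

end MDP

/-- The `n`-th transition `(sₙ, aₙ₊₁, sₙ₊₁)` of a run, if the computation has not stopped
before. -/
def transition {S A : Type*} (ω : ℕ → RunEntry A S) (n : ℕ) : Option (S × A × S) :=
  (ω (n + 1)).1.map fun a => ((ω n).2, a, (ω (n + 1)).2)

/-- The set of transitions that appear infinitely often in a run. -/
def infTransitions {S A : Type*} (ω : ℕ → RunEntry A S) : Set (S × A × S) :=
  {τ | {n | transition ω n = some τ}.Infinite}

/-! ### MDPs with rewards on transitions -/

/-- An MDP with undiscounted rewards on its transitions. -/
structure RewardMDP (S A : Type*) extends MDP S A where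
  reward : S → A → S → ℝ≥0∞

namespace RewardMDP

variable {S A : Type*} (R : RewardMDP S A)

/-- Total reward of a run. -/
noncomputable def total (ω : ℕ → RunEntry A S) : ℝ≥0∞ :=
  ∑' n, (transition ω n).elim 0 fun τ => R.reward τ.1 τ.2.1 τ.2.2

/-- Expected total reward of a strategy from state `s`. -/
noncomputable def expTotal [Countable S] [Countable A] (f : R.toMDP.Strategy) (s : S) : ℝ≥0∞ :=
  ∫⁻ ω, R.total ω ∂(f.runLaw s)

end RewardMDP

/-! ### MDPs with initial state and accepting transitions -/

/-- An MDP with an initial state and a set of accepting transitions. -/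
structure AccMDP (S A : Type*) extends MDP S A where
  init : S
  acc : Set (S × A × S)

namespace AccMDP

variable {S A : Type*} (P : AccMDP S A)

/-- Probability, from the initial state, of the Büchi objective under a strategy. -/
noncomputable def psat [Countable S] [Countable A] (f : P.toMDP.Strategy) : ℝ≥0∞ :=
  f.runLaw P.init {ω | (infTransitions ω ∩ P.acc).Nonempty}

open Classical in
/-- The distribution obtained from `p`, the distribution of the successor of `x` under `a`, by
redirecting accepting transitions to the target `t = none` with probability `1 - ζ` and
multiplying the probabilities of their original destinations by `ζ`. -/
noncomputable def redirect (ζ : Set.Ioo (0 : ℝ) 1) (x : S) (a : A) (p : PMF S) : PMF (Option S) :=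
  ⟨fun o => match o with
    | none => ∑' y, if (x, a, y) ∈ P.acc then ENNReal.ofReal (1 - ζ) * p y else 0
    | some y => if (x, a, y) ∈ P.acc then ENNReal.ofReal ζ * p y else p y, by
    rw [ENNReal.summable.hasSum_iff, ← (Equiv.optionEquivSumPUnit.{0} S).symm.tsum_eq,
      ENNReal.summable.tsum_sum ENNReal.summable, add_comm, ← p.tsum_coe]
    simp only [Equiv.optionEquivSumPUnit_symm_inl, Equiv.optionEquivSumPUnit_symm_inr,
      tsum_fintype, Finset.univ_unique, Finset.sum_singleton]
    rw [← ENNReal.tsum_add]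
    refine tsum_congr fun y => ?_
    split_ifs
    · rw [← add_mul, ← ENNReal.ofReal_add (by linarith [ζ.2.2]) ζ.2.1.le]
      simp
    · simp⟩

/-- The MDP `M^ζ`: the target `t = none` is added as a point where the computation stops, and
every accepting transition leads to it with probability `1 - ζ`. -/
noncomputable def reachMDP (ζ : Set.Ioo (0 : ℝ) 1) : MDP (Option S) A where
  T o a := match o with
    | none => none
    | some x => (P.T x a).map (P.redirect ζ x a)

/-- Probability, from the initial state, of reaching `t` in `M^ζ`. -/
noncomputable def preach [Countable S] [Countable A] (ζ : Set.Ioo (0 : ℝ) 1)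
    (f : (P.reachMDP ζ).Strategy) : ℝ≥0∞ :=
  f.runLaw (some P.init) {ω | ∃ n, (ω n).2 = none}

/-- The MDP with rewards built in the same way as `M^ζ`, where taking an accepting transition
earns reward `1`, whether it leads to `t` or not. (Only accepting transitions lead to `t`.) -/
noncomputable def rewardMDP (ζ : Set.Ioo (0 : ℝ) 1) : RewardMDP (Option S) A where
  toMDP := P.reachMDP ζ
  reward o a o' := match o, o' with
    | some x, some y => P.acc.indicator 1 (x, a, y)
    | some _, none => 1
    | none, _ => 0

/-- Expected total reward from the initial state. -/
noncomputable def etotal [Countable S] [Countable A] (ζ : Set.Ioo (0 : ℝ) 1)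
    (f : (P.rewardMDP ζ).toMDP.Strategy) : ℝ≥0∞ :=
  (P.rewardMDP ζ).expTotal f (some P.init)

/-! Every finite run of the MDP is a finite run of `M^ζ`, with the same available actions at its
end. -/

theorem avail_some (ζ : Set.Ioo (0 : ℝ) 1) (x : S) :
    (P.reachMDP ζ).avail (some x) = P.toMDP.avail x := by
  ext a
  simp [MDP.avail, reachMDP]

theorem lastState_embed (x : S) (l : List (A × S)) :
    lastState (some x) (l.map fun s => (s.1, some s.2)) = some (lastState x l) := by
  induction l generalizing x with
  | nil => rfl
  | cons s l ih => exact ih s.2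

open Classical in
theorem prob_pos (ζ : Set.Ioo (0 : ℝ) 1) (x : S) (a : A) (y : S) (h : 0 < P.toMDP.prob x a y) :
    0 < (P.reachMDP ζ).prob (some x) a (some y) := by
  unfold MDP.prob at *
  cases hT : P.T x a with
  | none => simp [hT] at h
  | some p =>
    simp only [hT, Option.elim_some] at h
    simp only [reachMDP, hT, Option.map_some, Option.elim_some]
    change 0 < (if (x, a, y) ∈ P.acc then ENNReal.ofReal ζ * p y else p y)
    split_ifs
    · exact ENNReal.mul_pos (ENNReal.ofReal_pos.2 ζ.2.1).ne' h.ne'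
    · exact h

theorem isPath_embed (ζ : Set.Ioo (0 : ℝ) 1) (x : S) (l : List (A × S))
    (h : P.toMDP.IsPath x l) :
    (P.reachMDP ζ).IsPath (some x) (l.map fun s => (s.1, some s.2)) := by
  induction l generalizing x with
  | nil => trivial
  | cons s l ih => exact ⟨P.prob_pos ζ x s.1 s.2 h.1, ih s.2 h.2⟩

/-- A finite run, read as a finite run of `M^ζ`. -/
def embed (ζ : Set.Ioo (0 : ℝ) 1) (r : P.toMDP.FRun) : (P.reachMDP ζ).FRun :=
  ⟨some r.first, r.steps.map fun s => (s.1, some s.2), P.isPath_embed ζ _ _ r.isPath⟩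

theorem avail_embed (ζ : Set.Ioo (0 : ℝ) 1) (r : P.toMDP.FRun) :
    (P.reachMDP ζ).avail (P.embed ζ r).last = P.toMDP.avail r.last := by
  rw [← P.avail_some ζ]
  exact congrArg _ (lastState_embed r.first r.steps)

/-- A strategy of `M^ζ`, read as a strategy of the MDP from which `M^ζ` was built: it makes the
same choice after every finite run. -/
def restrict (ζ : Set.Ioo (0 : ℝ) 1) (f : (P.reachMDP ζ).Strategy) : P.toMDP.Strategy where
  choose r := f.choose ⟨P.embed ζ r.1, by rw [P.avail_embed]; exact r.2⟩
  support_subset r := (f.support_subset _).trans (P.avail_embed ζ r.1).subset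

end AccMDP

/-! ### Büchi automata and the product -/

/-- A nondeterministic Büchi automaton with transition based acceptance. -/
structure BuchiAutomaton (Λ Q : Type*) where
  q₀ : Q
  Δ : Set (Q × Λ × Q)
  Γ : Set (Q × Λ × Q)

/-- An MDP whose transitions are labelled by letters. -/
structure LabelledMDP (S A Λ : Type*) extends MDP S A where
  L : S → A → S → Λ

namespace LabelledMDP

variable {S A Λ Q : Type*} (M : LabelledMDP S A Λ) (s₀ : S) (B : BuchiAutomaton Λ Q)

open Classical in
/-- Transition weights of the product: with action `(a, q')`, the automaton moves to `q'`. -/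
noncomputable def productWeight (x : S × Q) (b : A × Q) (y : S × Q) : ℝ≥0∞ :=
  if y.2 = b.2 ∧ (x.2, M.L x.1 b.1 y.1, y.2) ∈ B.Δ then M.toMDP.prob x.1 b.1 y.1 else 0

open Classical in
/-- The product `M × B`, with initial state `(s₀, q₀)`. An action `(a, q')` is available in a
state if the weights of its transitions form a probability distribution. -/
noncomputable def product : AccMDP (S × Q) (A × Q) where
  T x b := if h : HasSum (M.productWeight B x b) 1 then some ⟨M.productWeight B x b, h⟩ else none
  init := (s₀, B.q₀)
  acc := {τ | τ.2.2.2 = τ.2.1.2 ∧ (τ.1.2, M.L τ.1.1 τ.2.1.1 τ.2.2.1, τ.2.2.2) ∈ B.Γ ∧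
    0 < M.toMDP.prob τ.1.1 τ.2.1.1 τ.2.2.1}

end LabelledMDP

/-! Let `N` be the number of accepting transitions in a run of the product. A run prefix that avoids
`t` has in `M^ζ` its probability in the product multiplied by `ζ` to the number of its accepting
transitions (`lintegral_weight_mul`). Hence `t` is missed with probability `E[ζ ^ N]`, with `ζ ^ ∞ =
0` (`runLaw_reach_add`).

Claim (1) holds because no path leaves `t`, so the runs of `M^ζ` after which a decision is due are
exactly those of the product. For (2), if `α` is the total probability of accepting transitions
under an action, the expected reward of the step is `ζα + (1 - ζ)α = α`, while `t` is entered with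
probability `(1 - ζ)α`. Summing over time gives (2), since `t` is entered at most once; (3) follows
from (2). For (4), the reward is maximal iff `E[ζ ^ N] = 0`, that is, iff `N = ∞` almost surely; as
there are finitely many transitions, `N = ∞` is the Büchi objective.

For (5), let `v_ζ` (`missLimit`) be the limit of value iteration for `E[ζ ^ N]`. It is a lower bound
for every strategy, and finite-horizon optimal strategies show that it is the infimum. It increases
with `ζ`; let `v` (`missSup`) be its supremum. Since `ζ ^ N` is at most the indicator of `N < ∞`,
every strategy satisfies `PSat ≤ 1 - v(init)` (`psat_add_missSup_le`).

Conversely, let `f` be optimal for `ζ`. Then `ζ ^ Nₙ * v_ζ(Xₙ)`, with `Xₙ` the state and `Nₙ` the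
number of accepting transitions after `n` steps, has constant expectation, so `f` almost surely uses
only actions optimal for `v_ζ`. For `ζ` close to `1` these do not increase `v` on average
(`exists_forall_conserving`, by finiteness of the state-action pairs), so `E[v(Xₙ)] ≤ v(init)`.
Moreover `E[ζ ^ Nₙ * (1 - v(Xₙ))]` tends to `0`, so on `N < ∞` the value `v(Xₙ)` tends to `1` in
mean. Together these give `PSat(f) ≥ 1 - v(init)` (`one_le_missSup_add`). No memoryless optimal
strategy is needed. -/

theorem lastState_append {S A : Type*} (s : S) (l : List (A × S)) (a : A) (y : S) :
    lastState s (l ++ [(a, y)]) = y := by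
  induction l generalizing s with
  | nil => rfl
  | cons e l ih => exact ih e.2

/-! ### Paths and the distribution of one step -/

namespace MDP

variable {S A : Type*} {D : MDP S A}

theorem isPath_append (s : S) (l : List (A × S)) (a : A) (y : S) :
    D.IsPath s (l ++ [(a, y)]) ↔ D.IsPath s l ∧ 0 < D.prob (lastState s l) a y := by
  induction l generalizing s with
  | nil => simp [IsPath, lastState]
  | cons e l ih =>
    change (_ ∧ D.IsPath e.2 (l ++ [(a, y)])) ↔ (_ ∧ D.IsPath e.2 l) ∧ 0 < D.prob (lastState e.2 l) a y
    rw [ih, and_assoc]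

theorem tsum_prob {s : S} {a : A} (h : a ∈ D.avail s) : ∑' y, D.prob s a y = 1 := by
  obtain ⟨p, hp⟩ := Option.isSome_iff_exists.1 h
  simp [prob, hp, p.tsum_coe]

theorem prob_of_notMem {s : S} {a : A} (h : a ∉ D.avail s) (y : S) : D.prob s a y = 0 := by
  have : D.T s a = none := by simpa [avail] using h
  simp [prob, this]

theorem successor_apply_some (o : Option (PMF S)) (a b : A) (s y : S) [Decidable (b = a)] :
    (match o with
      | some p => p.map fun s' => (some a, s')
      | none => PMF.pure (none, s) : PMF (Option A × S)) (some b, y) =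
      if b = a then o.elim 0 (fun p => p y) else 0 := by
  classical
  cases o with
  | none => simp [PMF.pure_apply]
  | some p =>
    simp only [PMF.map_apply, Option.elim_some]
    split_ifs with h
    · subst h
      exact (tsum_eq_single y fun z hz => if_neg fun h => hz (congrArg Prod.snd h).symm).trans
        (if_pos rfl)
    · exact ENNReal.tsum_eq_zero.2 fun z =>
        if_neg fun h' => h (Option.some_injective _ (congrArg Prod.fst h'))

theorem successor_apply_none (p : PMF S) (a : A) (s y : S) :
    (match some p with
      | some p => p.map fun s' => (some a, s')
      | none => PMF.pure (none, s) : PMF (Option A × S)) (none, y) = 0 := by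
  classical
  simp [PMF.map_apply]

theorem Strategy.next_some (f : D.Strategy) (r : D.DecisionRun) (a : A) (y : S) :
    f.next r ((some a, y) : RunEntry A S) = f.choose r a * D.prob r.1.last a y := by
  classical
  refine (PMF.bind_apply _ _ _).trans ?_
  refine (tsum_congr fun b => congrArg (f.choose r b * ·)
    (successor_apply_some (D.T r.1.last b) b a r.1.last y)).trans ?_
  refine (tsum_eq_single a fun b hb => ?_).trans ?_
  · rw [if_neg hb.symm, mul_zero]
  · rw [if_pos rfl]
    rfl

theorem Strategy.next_none (f : D.Strategy) (r : D.DecisionRun) (y : S) :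
    f.next r ((none, y) : RunEntry A S) = 0 := by
  refine (PMF.bind_apply _ _ _).trans (ENNReal.tsum_eq_zero.2 fun b => ?_)
  by_cases hb : b ∈ D.avail r.1.last
  · obtain ⟨p, hp⟩ := Option.isSome_iff_exists.1 hb
    rw [hp]
    exact mul_eq_zero_of_right _ (successor_apply_none p b r.1.last y)
  · refine mul_eq_zero_of_left ?_ _
    rw [PMF.apply_eq_zero_iff]
    exact fun h => hb (f.support_subset r h)

theorem Strategy.tsum_next (f : D.Strategy) (r : D.DecisionRun) (g : RunEntry A S → ℝ≥0∞) :
    ∑' e, f.next r e * g e =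
      ∑' a, f.choose r a * ∑' y, D.prob r.1.last a y * g ((some a, y) : RunEntry A S) := by
  have h : ∑' e, f.next r e * g e = ∑' (o : Option A) (y : S),
      f.next r ((o, y) : RunEntry A S) * g ((o, y) : RunEntry A S) :=
    ENNReal.tsum_prod (f := fun (o : Option A) (y : S) =>
      f.next r ((o, y) : RunEntry A S) * g ((o, y) : RunEntry A S))
  rw [h, ← (Equiv.optionEquivSumPUnit.{0} A).symm.tsum_eq,
    ENNReal.summable.tsum_sum ENNReal.summable]
  simp only [Equiv.optionEquivSumPUnit_symm_inl, Equiv.optionEquivSumPUnit_symm_inr,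
    next_some, next_none, zero_mul, tsum_zero, add_zero, ← ENNReal.tsum_mul_left, mul_assoc]

/-! ### Prefixes of infinite runs as finite runs -/

/-- The steps among the entries `1, …, n` of a run. -/
def runSteps (ω : ℕ → RunEntry A S) (n : ℕ) : List (A × S) :=
  histSteps (Preorder.frestrictLe (π := fun _ => RunEntry A S) n ω)

theorem runSteps_succ (ω : ℕ → RunEntry A S) (n : ℕ) :
    runSteps ω (n + 1) =
      runSteps ω n ++ ((ω (n + 1)).1.map fun a => (a, (ω (n + 1)).2)).toList := by
  unfold runSteps histSteps
  rw [List.finRange_succ_last, List.filterMap_append, List.filterMap_map]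
  refine congrArg _ ?_
  simp only [List.filterMap_cons, List.filterMap_nil, Preorder.frestrictLe_apply, Fin.val_last]
  cases (ω (n + 1)).1 <;> rfl

/-- The law of entry `n + 1` of a run, given the entries up to `n` of `ω`. -/
noncomputable def Strategy.nextLaw (f : D.Strategy) (ω : ℕ → RunEntry A S) (n : ℕ) :
    PMF (RunEntry A S) :=
  f.stepLaw n (Preorder.frestrictLe (π := fun _ => RunEntry A S) n ω)

theorem Strategy.nextLaw_congr (f : D.Strategy) {ω ω' : ℕ → RunEntry A S} {n : ℕ}
    (h : ∀ k ≤ n, ω k = ω' k) : f.nextLaw ω n = f.nextLaw ω' n := by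
  unfold nextLaw
  congr 1
  funext i
  exact h i (Finset.mem_Iic.1 i.2)

/-- The entries up to `n` form a run that is at the last state of a finite run of the MDP;
all its steps have been taken unless the computation has stopped. -/
structure IsRunUpTo (D : MDP S A) (ω : ℕ → RunEntry A S) (n : ℕ) : Prop where
  isPath : D.IsPath (ω 0).2 (runSteps ω n)
  last : lastState (ω 0).2 (runSteps ω n) = (ω n).2
  length : (D.avail (ω n).2).Nonempty → (runSteps ω n).length = n

/-- The finite run formed by the entries up to `n`. -/
def IsRunUpTo.fRun {ω : ℕ → RunEntry A S} {n : ℕ} (h : D.IsRunUpTo ω n) : D.FRun :=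
  ⟨(ω 0).2, runSteps ω n, h.isPath⟩

/-- The finite run formed by the entries up to `n`, if the computation does not stop. -/
def IsRunUpTo.decisionRun {ω : ℕ → RunEntry A S} {n : ℕ} (h : D.IsRunUpTo ω n)
    (hn : (D.avail (ω n).2).Nonempty) : D.DecisionRun :=
  ⟨h.fRun, by rw [← h.last] at hn; exact hn⟩

theorem Strategy.nextLaw_of_nonempty (f : D.Strategy) {ω : ℕ → RunEntry A S} {n : ℕ}
    (h : D.IsRunUpTo ω n) (hn : (D.avail (ω n).2).Nonempty) :
    f.nextLaw ω n = f.next (h.decisionRun hn) :=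
  dif_pos ⟨h.isPath, (h.decisionRun hn).2⟩

theorem Strategy.nextLaw_of_not_nonempty (f : D.Strategy) {ω : ℕ → RunEntry A S} {n : ℕ}
    (h : D.IsRunUpTo ω n) (hn : ¬ (D.avail (ω n).2).Nonempty) :
    f.nextLaw ω n = PMF.pure ((none, (ω n).2) : RunEntry A S) := by
  refine dif_neg ?_
  rintro ⟨hp, h'⟩
  rw [← h.last] at hn
  exact hn h'

theorem Strategy.tsum_nextLaw_of_nonempty (f : D.Strategy) {ω : ℕ → RunEntry A S} {n : ℕ}
    (h : D.IsRunUpTo ω n) (hn : (D.avail (ω n).2).Nonempty) (g : RunEntry A S → ℝ≥0∞) :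
    ∑' e, f.nextLaw ω n e * g e = ∑' a, f.choose (h.decisionRun hn) a *
      ∑' y, D.prob (ω n).2 a y * g ((some a, y) : RunEntry A S) := by
  rw [f.nextLaw_of_nonempty h hn, f.tsum_next]
  have : (h.decisionRun hn).1.last = (ω n).2 := h.last
  rw [this]

theorem Strategy.tsum_nextLaw_of_not_nonempty (f : D.Strategy) {ω : ℕ → RunEntry A S} {n : ℕ}
    (h : D.IsRunUpTo ω n) (hn : ¬ (D.avail (ω n).2).Nonempty) (g : RunEntry A S → ℝ≥0∞) :
    ∑' e, f.nextLaw ω n e * g e = g ((none, (ω n).2) : RunEntry A S) := by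
  classical
  rw [f.nextLaw_of_not_nonempty h hn]
  refine (tsum_eq_single (β := RunEntry A S) ((none, (ω n).2) : RunEntry A S) fun e he => ?_).trans
    ?_
  · exact mul_eq_zero_of_left ((PMF.pure_apply _ _).trans (if_neg he)) _
  · exact (congrArg (· * _) ((PMF.pure_apply _ _).trans (if_pos rfl))).trans (one_mul _)

theorem IsRunUpTo.zero {ω : ℕ → RunEntry A S} : D.IsRunUpTo ω 0 :=
  ⟨trivial, rfl, fun _ => rfl⟩

/-- A possible next entry either appends a step of positive probability or, where the computation
has stopped, repeats the state and leaves the list of steps unchanged. In the second case the length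
condition is vacuous. -/
theorem IsRunUpTo.succ {f : D.Strategy} {ω : ℕ → RunEntry A S} {n : ℕ} (h : D.IsRunUpTo ω n)
    (h1 : f.nextLaw ω n (ω (n + 1)) ≠ 0) : D.IsRunUpTo ω (n + 1) := by
  classical
  by_cases hn : (D.avail (ω n).2).Nonempty
  · rw [f.nextLaw_of_nonempty h hn] at h1
    have hl : (h.decisionRun hn).1.last = (ω n).2 := h.last
    rcases he : ω (n + 1) with ⟨_ | a, y⟩
    · rw [he] at h1
      exact absurd (f.next_none _ y) h1
    · have hs : runSteps ω (n + 1) = runSteps ω n ++ [(a, y)] := by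
        rw [runSteps_succ, he]; rfl
      have h2 : f.choose (h.decisionRun hn) a * D.prob (h.decisionRun hn).1.last a y ≠ 0 := by
        rw [← f.next_some, ← he]; exact h1
      refine ⟨?_, ?_, fun _ => ?_⟩
      · rw [hs, isPath_append]
        exact ⟨h.isPath, pos_iff_ne_zero.2 (right_ne_zero_of_mul h2)⟩
      · rw [hs, lastState_append, he]
      · rw [hs, List.length_append, h.length hn]; rfl
  · rw [f.nextLaw_of_not_nonempty h hn] at h1
    have he : ω (n + 1) = ((none, (ω n).2) : RunEntry A S) := by
      by_contra hc; exact h1 ((PMF.pure_apply _ _).trans (if_neg hc))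
    have hs : runSteps ω (n + 1) = runSteps ω n := by
      rw [runSteps_succ, he]; exact List.append_nil _
    have h2 : (ω (n + 1)).2 = (ω n).2 := by rw [he]
    exact ⟨hs ▸ h.isPath, by rw [hs, h2, h.last], fun h' => absurd (h2 ▸ h') hn⟩

/-- The sequence that repeats entry `n` from then on. -/
def extendHist {n : ℕ} (x : (i : Finset.Iic n) → RunEntry A S) : ℕ → RunEntry A S :=
  fun k => if h : k ≤ n then x ⟨k, Finset.mem_Iic.2 h⟩ else x ⟨n, Finset.mem_Iic.2 le_rfl⟩

theorem extendHist_frestrictLe (ω : ℕ → RunEntry A S) {n k : ℕ} (h : k ≤ n) :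
    extendHist (Preorder.frestrictLe (π := fun _ => RunEntry A S) n ω) k = ω k := by
  simp [extendHist, h]

/-! ### The law of a run under a strategy -/

section Law

variable [Countable S] [Countable A]

instance (f : D.Strategy) (s : S) : IsProbabilityMeasure (f.runLaw s) := by
  have : IsProbabilityMeasure (Measure.dirac (α := RunEntry A S) (none, s)) :=
    Measure.dirac.isProbabilityMeasure
  unfold Strategy.runLaw; infer_instance

/-- Such a function factors through the histories of length `n`, a countable discrete space. -/
theorem measurable_of_prefix {β : Type*} [MeasurableSpace β] (n : ℕ) (G : (ℕ → RunEntry A S) → β)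
    (hG : ∀ ω ω', (∀ k ≤ n, ω k = ω' k) → G ω = G ω') : Measurable G := by
  have : G = (fun x => G (extendHist x)) ∘
      Preorder.frestrictLe (π := fun _ => RunEntry A S) n := by
    funext ω
    exact hG _ _ fun k hk => (extendHist_frestrictLe ω hk).symm
  rw [this]
  exact (measurable_of_countable _).comp (Preorder.measurable_frestrictLe _)

/-- Averaging over entry `n + 1`, given the entries before. -/
theorem Strategy.lintegral_step (f : D.Strategy) (s : S) (n : ℕ)
    (G : (ℕ → RunEntry A S) → RunEntry A S → ℝ≥0∞)
    (hG : ∀ ω ω' e, (∀ k ≤ n, ω k = ω' k) → G ω e = G ω' e) :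
    ∫⁻ ω, G ω (ω (n + 1)) ∂f.runLaw s =
      ∫⁻ ω, ∑' e, f.nextLaw ω n e * G ω e ∂f.runLaw s := by
  have : IsProbabilityMeasure (Measure.dirac (α := RunEntry A S) (none, s)) :=
    Measure.dirac.isProbabilityMeasure
  -- The joint law of the history up to `n` and entry `n + 1` is the law of the history composed
  -- with the step kernel.
  have key := Kernel.map_frestrictLe_trajMeasure_compProd_eq_map_trajMeasure
    (X := fun _ => RunEntry A S) (μ₀ := Measure.dirac ((none, s) : RunEntry A S))
    (κ := f.stepKernel) (a := n)
  have hm : Measurable fun p : ((i : Finset.Iic n) → RunEntry A S) × RunEntry A S =>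
      G (extendHist p.1) p.2 := measurable_of_countable _
  have hfr : Measurable (Preorder.frestrictLe (π := fun _ => RunEntry A S) n) :=
    Preorder.measurable_frestrictLe _
  have h1 := congrArg (fun μ => ∫⁻ p, G (extendHist p.1) p.2 ∂μ) key
  rw [Measure.lintegral_compProd hm, lintegral_map (measurable_of_countable _) hfr,
    lintegral_map hm (by fun_prop)] at h1
  calc ∫⁻ ω, G ω (ω (n + 1)) ∂f.runLaw s
      = ∫⁻ ω, G (extendHist (Preorder.frestrictLe (π := fun _ => RunEntry A S) n ω)) (ω (n + 1))
          ∂f.runLaw s := by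
        refine lintegral_congr fun ω => hG _ _ _ fun k hk => (extendHist_frestrictLe ω hk).symm
    _ = _ := h1.symm
    _ = _ := by
        refine lintegral_congr fun ω => ?_
        rw [lintegral_countable']
        refine tsum_congr fun e => ?_
        rw [mul_comm, hG _ ω e fun k hk => extendHist_frestrictLe ω hk]
        congr 1
        exact PMF.toMeasure_apply_singleton _ _ (MeasurableSet.singleton e)

theorem Strategy.ae_zero (f : D.Strategy) (s : S) :
    ∀ᵐ ω ∂f.runLaw s, ω 0 = ((none, s) : RunEntry A S) := by
  have : IsProbabilityMeasure (Measure.dirac (α := RunEntry A S) (none, s)) :=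
    Measure.dirac.isProbabilityMeasure
  have h1 : (f.runLaw s).map (Preorder.frestrictLe (π := fun _ => RunEntry A S) 0) =
      (Measure.dirac (α := RunEntry A S) (none, s)).map
        (MeasurableEquiv.piUnique fun _ : Finset.Iic 0 => RunEntry A S).symm := by
    unfold Strategy.runLaw Kernel.trajMeasure
    rw [Measure.map_comp _ _ (by fun_prop), Kernel.traj_map_frestrictLe, Kernel.partialTraj_self,
      Measure.id_comp]
  have h2 : ∀ᵐ x ∂(f.runLaw s).map (Preorder.frestrictLe (π := fun _ => RunEntry A S) 0),
      x ⟨0, by simp⟩ = ((none, s) : RunEntry A S) := by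
    rw [h1, ae_map_iff (by fun_prop) (Set.to_countable _).measurableSet]
    exact (ae_dirac_iff (α := RunEntry A S) (Set.to_countable _).measurableSet).2 rfl
  exact ae_of_ae_map (Preorder.measurable_frestrictLe _).aemeasurable h2

/-- The entries of conditional mass zero have total conditional mass zero; averaging their indicator
gives the claim. -/
theorem Strategy.ae_step (f : D.Strategy) (s : S) (n : ℕ) :
    ∀ᵐ ω ∂f.runLaw s, f.nextLaw ω n (ω (n + 1)) ≠ 0 := by
  classical
  have := f.lintegral_step s n (fun ω e => if f.nextLaw ω n e = 0 then 1 else 0)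
    (fun ω ω' e h => by rw [f.nextLaw_congr h])
  have h0 : ∀ ω : ℕ → RunEntry A S,
      ∑' e, f.nextLaw ω n e * (if f.nextLaw ω n e = 0 then (1 : ℝ≥0∞) else 0) = 0 := by
    intro ω
    rw [ENNReal.tsum_eq_zero]
    intro e
    split_ifs with h <;> simp [h]
  simp only [h0, lintegral_zero] at this
  rw [lintegral_eq_zero_iff] at this
  · filter_upwards [this] with ω h h'
    simp [h'] at h
  · refine measurable_of_prefix (n + 1) _ fun ω ω' h => ?_
    rw [f.nextLaw_congr fun k hk => h k (hk.trans n.le_succ), h _ le_rfl]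

theorem Strategy.ae_isRunUpTo (f : D.Strategy) (s : S) :
    ∀ᵐ ω ∂f.runLaw s, ∀ n, D.IsRunUpTo ω n := by
  filter_upwards [ae_all_iff.2 (f.ae_step s)] with ω h n
  induction n with
  | zero => exact .zero
  | succ n ih => exact ih.succ (h n)

end Law

end MDP

/-! ### Embedding of runs and transition probabilities of `M^ζ` -/

theorem tsum_option_ennreal {S : Type*} (g : Option S → ℝ≥0∞) :
    ∑' o, g o = ∑' y, g (some y) + g none := by
  rw [← (Equiv.optionEquivSumPUnit.{0} S).symm.tsum_eq,
    ENNReal.summable.tsum_sum ENNReal.summable]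
  simp

/-- An entry of a run, read as an entry of a run of the MDP with an additional state. -/
def embedEntry {S A : Type*} (e : RunEntry A S) : RunEntry A (Option S) := (e.1, some e.2)

theorem embedEntry_injective {S A : Type*} :
    Function.Injective (embedEntry : RunEntry A S → RunEntry A (Option S)) := by
  rintro ⟨o, x⟩ ⟨o', x'⟩ h
  have h1 : o = o' := congrArg (fun e : RunEntry A (Option S) => e.1) h
  have h2 : some x = some x' := congrArg (fun e : RunEntry A (Option S) => e.2) h
  rw [h1, Option.some_injective _ h2]

/-- A run, read as a run of the MDP with an additional state. -/
def embedRun {S A : Type*} (ω : ℕ → RunEntry A S) : ℕ → RunEntry A (Option S) :=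
  fun k => embedEntry (ω k)

namespace AccMDP

variable {S A : Type*} (P : AccMDP S A)

open Classical in
/-- The factor of the transition from `x` to `y` under `a`. -/
noncomputable def transWeight (ζ : Set.Ioo (0 : ℝ) 1) (x : S) (a : A) (y : S) : ℝ≥0∞ :=
  if (x, a, y) ∈ P.acc then ENNReal.ofReal ζ else 1

theorem reachMDP_prob_some (ζ : Set.Ioo (0 : ℝ) 1) (x : S) (a : A) (y : S) :
    (P.reachMDP ζ).prob (some x) a (some y) = P.transWeight ζ x a y * P.toMDP.prob x a y := by
  classical
  unfold MDP.prob
  simp only [reachMDP]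
  cases hT : P.T x a with
  | none => simp
  | some p =>
    simp only [Option.map_some, Option.elim_some]
    change (if (x, a, y) ∈ P.acc then ENNReal.ofReal ζ * p y else p y) = _
    unfold transWeight
    split_ifs <;> simp

open Classical in
theorem reachMDP_prob_none (ζ : Set.Ioo (0 : ℝ) 1) (x : S) (a : A) :
    (P.reachMDP ζ).prob (some x) a none =
      ∑' y, if (x, a, y) ∈ P.acc then ENNReal.ofReal (1 - ζ) * P.toMDP.prob x a y else 0 := by
  unfold MDP.prob
  simp only [reachMDP]
  cases hT : P.T x a with
  | none => simp
  | some p => rfl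

theorem not_nonempty_avail_none (ζ : Set.Ioo (0 : ℝ) 1) :
    ¬ ((P.reachMDP ζ).avail none).Nonempty := by
  rintro ⟨a, ha⟩
  exact Bool.false_ne_true ha

theorem transWeight_le_one (ζ : Set.Ioo (0 : ℝ) 1) (x : S) (a : A) (y : S) :
    P.transWeight ζ x a y ≤ 1 := by
  unfold transWeight
  split_ifs
  · exact ENNReal.ofReal_le_one.2 ζ.2.2.le
  · exact le_rfl

/-! ### Strategies -/

/-- Nothing is available in `t`, so a path that visits `t` ends there; a path ending where a
decision is due has therefore avoided it. Positivity of the steps carries over because the factors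
only scale the original probabilities. -/
theorem exists_embed_of_isPath (ζ : Set.Ioo (0 : ℝ) 1) (o : Option S) (l : List (A × Option S))
    (h : (P.reachMDP ζ).IsPath o l) (hl : ((P.reachMDP ζ).avail (lastState o l)).Nonempty) :
    ∃ x l', P.toMDP.IsPath x l' ∧ o = some x ∧ l = l'.map fun s => (s.1, some s.2) := by
  induction l generalizing o with
  | nil =>
    cases o with
    | none => exact absurd hl (P.not_nonempty_avail_none ζ)
    | some x => exact ⟨x, [], trivial, rfl, rfl⟩
  | cons e l ih =>
    obtain ⟨h1, h2⟩ := h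
    obtain ⟨y, l', hy, he, rfl⟩ := ih e.2 h2 hl
    cases o with
    | none => exact absurd h1 (lt_irrefl 0)
    | some x =>
      rw [he, reachMDP_prob_some] at h1
      refine ⟨x, (e.1, y) :: l', ⟨pos_iff_ne_zero.2 (right_ne_zero_of_mul h1.ne'), hy⟩, rfl, ?_⟩
      rw [List.map_cons, ← he]

/-- A decision run, read as a decision run of `M^ζ`. -/
def embedDecision (ζ : Set.Ioo (0 : ℝ) 1) (r : P.toMDP.DecisionRun) :
    (P.reachMDP ζ).DecisionRun :=
  ⟨P.embed ζ r.1, by rw [P.avail_embed]; exact r.2⟩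

theorem embedDecision_bijective (ζ : Set.Ioo (0 : ℝ) 1) :
    Function.Bijective (P.embedDecision ζ) := by
  constructor
  · rintro ⟨⟨x, l, h⟩, h1⟩ ⟨⟨x', l', h'⟩, h1'⟩ heq
    have h2 := congrArg Subtype.val heq
    simp only [embedDecision, embed, MDP.FRun.mk.injEq, Option.some.injEq] at h2
    obtain ⟨rfl, h3⟩ := h2
    have : l = l' := by
      refine List.map_injective_iff.2 ?_ h3
      rintro ⟨a, y⟩ ⟨a', y'⟩ h
      simpa using h
    subst this
    rfl
  · rintro ⟨⟨o, l, h⟩, h1⟩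
    obtain ⟨x, l', hx, rfl, rfl⟩ := P.exists_embed_of_isPath ζ o l h h1
    refine ⟨⟨⟨x, l', hx⟩, ?_⟩, rfl⟩
    have := P.avail_embed ζ ⟨x, l', hx⟩
    rw [← this]
    exact h1

theorem restrict_choose (ζ : Set.Ioo (0 : ℝ) 1) (f : (P.reachMDP ζ).Strategy)
    (r : P.toMDP.DecisionRun) : (P.restrict ζ f).choose r = f.choose (P.embedDecision ζ r) := rfl

/-- Restriction is precomposition with the bijection `embedDecision`, and the available actions at
both ends agree. -/
theorem restrict_bijective (ζ : Set.Ioo (0 : ℝ) 1) : Function.Bijective (P.restrict ζ) := by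
  constructor
  · rintro ⟨f, hf⟩ ⟨g, hg⟩ h
    have : f = g := by
      funext r
      obtain ⟨r, rfl⟩ := (P.embedDecision_bijective ζ).2 r
      exact congrFun (congrArg MDP.Strategy.choose h) r
    subst this
    rfl
  · intro g
    let E := Equiv.ofBijective _ (P.embedDecision_bijective ζ)
    refine ⟨⟨fun r => g.choose (E.symm r), fun r => ?_⟩, ?_⟩
    · refine (g.support_subset _).trans (le_of_eq ?_)
      rw [← P.avail_embed ζ]
      have h1 : P.embedDecision ζ (E.symm r) = r := E.apply_symm_apply r
      exact congrArg (fun r : (P.reachMDP ζ).DecisionRun => (P.reachMDP ζ).avail r.1.last) h1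
    · have : ∀ r, E.symm (P.embedDecision ζ r) = r := E.symm_apply_apply
      cases g with
      | mk g hg =>
        simp only [restrict, MDP.Strategy.mk.injEq]
        funext r
        exact congrArg g (this r)

/-! ### The weight of a run -/

/-- The transition number `n` of the run is accepting. -/
def AccAt (ω : ℕ → RunEntry A S) (n : ℕ) : Prop := ∃ τ ∈ P.acc, transition ω n = some τ

/-- The factor of the next entry of a run in state `x`. -/
noncomputable def entryWeight (ζ : Set.Ioo (0 : ℝ) 1) (x : S) (e : RunEntry A S) : ℝ≥0∞ :=
  e.1.elim 1 fun a => P.transWeight ζ x a e.2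

open Classical in
/-- `ζ` to the number of accepting transitions among the first `n`. -/
noncomputable def weight (ζ : Set.Ioo (0 : ℝ) 1) (n : ℕ) (ω : ℕ → RunEntry A S) : ℝ≥0∞ :=
  ENNReal.ofReal ζ ^ Nat.count (P.AccAt ω) n

theorem weight_zero (ζ : Set.Ioo (0 : ℝ) 1) (ω : ℕ → RunEntry A S) : P.weight ζ 0 ω = 1 := by
  simp [weight]

theorem weight_succ (ζ : Set.Ioo (0 : ℝ) 1) (n : ℕ) (ω : ℕ → RunEntry A S) :
    P.weight ζ (n + 1) ω = P.weight ζ n ω * P.entryWeight ζ (ω n).2 (ω (n + 1)) := by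
  classical
  unfold weight entryWeight
  rw [Nat.count_succ, pow_add]
  congr 1
  rcases h : (ω (n + 1)).1 with _ | a
  · have : ¬ P.AccAt ω n := by simp [AccAt, transition, h]
    simp [this]
  · have : P.AccAt ω n ↔ ((ω n).2, a, (ω (n + 1)).2) ∈ P.acc := by simp [AccAt, transition, h]
    simp only [this, Option.elim_some, transWeight]
    split_ifs <;> simp

theorem entryWeight_le_one (ζ : Set.Ioo (0 : ℝ) 1) (x : S) (e : RunEntry A S) :
    P.entryWeight ζ x e ≤ 1 := by
  unfold entryWeight
  cases e.1 with
  | none => exact le_rfl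
  | some a => exact P.transWeight_le_one ..

theorem weight_congr (ζ : Set.Ioo (0 : ℝ) 1) {n : ℕ} {ω ω' : ℕ → RunEntry A S}
    (h : ∀ k ≤ n, ω k = ω' k) : P.weight ζ n ω = P.weight ζ n ω' := by
  induction n with
  | zero => rw [weight_zero, weight_zero]
  | succ n ih =>
    rw [weight_succ, weight_succ, ih fun k hk => h k (hk.trans n.le_succ), h n n.le_succ,
      h (n + 1) le_rfl]

theorem weight_antitone (ζ : Set.Ioo (0 : ℝ) 1) (ω : ℕ → RunEntry A S) :
    Antitone fun n => P.weight ζ n ω := by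
  refine antitone_nat_of_succ_le fun n => ?_
  rw [weight_succ]
  exact mul_le_of_le_one_right' (P.entryWeight_le_one ..)

theorem weight_le_one (ζ : Set.Ioo (0 : ℝ) 1) (n : ℕ) (ω : ℕ → RunEntry A S) :
    P.weight ζ n ω ≤ 1 :=
  (P.weight_antitone ζ ω n.zero_le).trans (P.weight_zero ζ ω).le

theorem weight_ne_zero (ζ : Set.Ioo (0 : ℝ) 1) (n : ℕ) (ω : ℕ → RunEntry A S) :
    P.weight ζ n ω ≠ 0 :=
  pow_ne_zero _ (ENNReal.ofReal_pos.2 ζ.2.1).ne'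

theorem weight_ne_top (ζ : Set.Ioo (0 : ℝ) 1) (n : ℕ) (ω : ℕ → RunEntry A S) :
    P.weight ζ n ω ≠ ∞ :=
  ((P.weight_le_one ζ n ω).trans_lt ENNReal.one_lt_top).ne

theorem measurable_weight [Countable S] [Countable A] (ζ : Set.Ioo (0 : ℝ) 1) (n : ℕ) :
    Measurable (P.weight ζ n) :=
  MDP.measurable_of_prefix n _ fun _ _ h => P.weight_congr ζ h

/-- Since `0 < ζ < 1`, the powers decrease to `0` exactly when there are infinitely many accepting
transitions in the run. -/
theorem iInf_weight_eq_zero_iff [Finite S] [Finite A] (ζ : Set.Ioo (0 : ℝ) 1)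
    (ω : ℕ → RunEntry A S) :
    ⨅ n, P.weight ζ n ω = 0 ↔ (infTransitions ω ∩ P.acc).Nonempty := by
  classical
  have h1 : (infTransitions ω ∩ P.acc).Nonempty ↔ {n | P.AccAt ω n}.Infinite := by
    constructor
    · rintro ⟨τ, hτ, hacc⟩
      exact hτ.mono fun n hn => ⟨τ, hacc, hn⟩
    · intro h
      by_contra hc
      -- Pigeonhole: if each of the finitely many accepting transitions occurred finitely often,
      -- there would be finitely many accepting times.
      refine h (Set.Finite.subset (Set.toFinite P.acc |>.biUnion (t := fun τ =>
        {n | transition ω n = some τ}) fun τ hτ => ?_) ?_)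
      · by_contra h'
        exact hc ⟨τ, h', hτ⟩
      · rintro n ⟨τ, hτ, hn⟩
        exact Set.mem_biUnion hτ hn
  rw [h1]
  have hlt : ENNReal.ofReal ζ < 1 := ENNReal.ofReal_lt_one.2 ζ.2.2
  constructor
  · intro h hfin
    have h2 : ∀ n, ENNReal.ofReal ζ ^ hfin.toFinset.card ≤ P.weight ζ n ω := fun n =>
      pow_le_pow_right_of_le_one' hlt.le (Nat.count_le_card hfin n)
    have h3 := le_iInf h2
    rw [h] at h3
    exact pow_ne_zero _ (ENNReal.ofReal_pos.2 ζ.2.1).ne' (le_zero_iff.1 h3)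
  · intro h
    refine le_antisymm ?_ zero_le
    refine ge_of_tendsto' (ENNReal.tendsto_pow_atTop_nhds_zero_of_lt_one hlt) fun k => ?_
    -- Just before the accepting transition number `k` (counted from `0`), exactly `k` have been
    -- taken, so the weight is `ζ ^ k`.
    refine (iInf_le _ (Nat.nth (P.AccAt ω) k)).trans (le_of_eq ?_)
    unfold weight
    rw [Nat.count_nth_of_infinite h]

/-! ### The law of a run in `M^ζ` -/

theorem runSteps_embedRun (ω : ℕ → RunEntry A S) (n : ℕ) :
    MDP.runSteps (embedRun ω) n = (MDP.runSteps ω n).map fun s => (s.1, some s.2) := by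
  induction n with
  | zero => rfl
  | succ n ih =>
    rw [MDP.runSteps_succ, MDP.runSteps_succ, ih, List.map_append]
    congr 1
    simp only [embedRun, embedEntry]
    cases (ω (n + 1)).1 <;> rfl

variable {P} in
theorem isRunUpTo_embedRun (ζ : Set.Ioo (0 : ℝ) 1) {ω : ℕ → RunEntry A S} {n : ℕ}
    (h : P.toMDP.IsRunUpTo ω n) : (P.reachMDP ζ).IsRunUpTo (embedRun ω) n := by
  refine ⟨?_, ?_, ?_⟩
  · rw [runSteps_embedRun]
    exact P.isPath_embed ζ _ _ h.isPath
  · rw [runSteps_embedRun]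
    exact (lastState_embed _ _).trans (congrArg some h.last)
  · rw [runSteps_embedRun, List.length_map]
    intro h'
    exact h.length ((P.avail_some ζ (ω n).2) ▸ h')

/-- The change of measure for one step. The choice of action is the same in both processes, so only
the factor of the transition remains. -/
theorem nextLaw_embedRun (ζ : Set.Ioo (0 : ℝ) 1) (f : (P.reachMDP ζ).Strategy)
    {ω : ℕ → RunEntry A S} {n : ℕ} (h : P.toMDP.IsRunUpTo ω n) (e : RunEntry A S) :
    f.nextLaw (embedRun ω) n (embedEntry e) =
      P.entryWeight ζ (ω n).2 e * (P.restrict ζ f).nextLaw ω n e := by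
  classical
  have h' := isRunUpTo_embedRun ζ h
  have hav : (P.reachMDP ζ).avail (embedRun ω n).2 = P.toMDP.avail (ω n).2 :=
    P.avail_some ζ (ω n).2
  by_cases hn : (P.toMDP.avail (ω n).2).Nonempty
  · have hn' : ((P.reachMDP ζ).avail (embedRun ω n).2).Nonempty := by rw [hav]; exact hn
    rw [f.nextLaw_of_nonempty h' hn', (P.restrict ζ f).nextLaw_of_nonempty h hn]
    have hr : h'.decisionRun hn' = P.embedDecision ζ (h.decisionRun hn) := by
      refine Subtype.ext ?_
      simp only [MDP.IsRunUpTo.decisionRun, MDP.IsRunUpTo.fRun, embedDecision, embed,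
        MDP.FRun.mk.injEq]
      exact ⟨rfl, runSteps_embedRun ω n⟩
    have hl : (h.decisionRun hn).1.last = (ω n).2 := h.last
    have hl' : (h'.decisionRun hn').1.last = some (ω n).2 := h'.last
    rcases e with ⟨_ | a, y⟩
    · refine (f.next_none _ _).trans ?_
      exact (mul_eq_zero_of_right _ ((P.restrict ζ f).next_none _ y)).symm
    · refine (f.next_some _ _ _).trans ?_
      rw [hl']
      refine Eq.trans ?_ (congrArg (P.entryWeight ζ (ω n).2 ((some a, y) : RunEntry A S) * ·)
        ((P.restrict ζ f).next_some (h.decisionRun hn) a y)).symm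
      rw [hl, P.reachMDP_prob_some, P.restrict_choose, hr]
      exact mul_left_comm _ _ _
  · have hn' : ¬ ((P.reachMDP ζ).avail (embedRun ω n).2).Nonempty := by rw [hav]; exact hn
    rw [f.nextLaw_of_not_nonempty h' hn', (P.restrict ζ f).nextLaw_of_not_nonempty h hn]
    refine (PMF.pure_apply _ _).trans (Eq.trans ?_
      (congrArg (P.entryWeight ζ (ω n).2 e * ·) (PMF.pure_apply _ _)).symm)
    by_cases he : e = ((none, (ω n).2) : RunEntry A S)
    · subst he
      exact (if_pos rfl).trans ((mul_one _).symm.trans (congrArg _ (if_pos rfl).symm))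
    · rw [if_neg he, mul_zero]
      exact if_neg fun hc => he (embedEntry_injective hc)

/-- A prefix of a run has in `M^ζ` its probability in the original MDP times its weight. -/
theorem lintegral_weight_mul [Countable S] [Countable A] (ζ : Set.Ioo (0 : ℝ) 1)
    (f : (P.reachMDP ζ).Strategy) (s : S) (n : ℕ) (K : (ℕ → RunEntry A (Option S)) → ℝ≥0∞)
    (hK : ∀ ω ω', (∀ k ≤ n, ω k = ω' k) → K ω = K ω')
    (hK0 : ∀ ω, (∃ k ≤ n, (ω k).2 = none) → K ω = 0) :
    ∫⁻ ω, K ω ∂f.runLaw (some s) =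
      ∫⁻ ω, P.weight ζ n ω * K (embedRun ω) ∂(P.restrict ζ f).runLaw s := by
  classical
  induction n generalizing K with
  | zero =>
    let c : ℕ → RunEntry A S := fun _ => (none, s)
    have h1 : ∀ᵐ ω ∂f.runLaw (some s), K ω = K (embedRun c) := by
      filter_upwards [f.ae_zero (some s)] with ω hω
      refine hK _ _ fun k hk => ?_
      rw [Nat.le_zero.1 hk, hω]
      rfl
    have h2 : ∀ᵐ ω ∂(P.restrict ζ f).runLaw s,
        P.weight ζ 0 ω * K (embedRun ω) = K (embedRun c) := by
      filter_upwards [(P.restrict ζ f).ae_zero s] with ω hω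
      rw [weight_zero, one_mul]
      refine hK _ _ fun k hk => ?_
      rw [Nat.le_zero.1 hk]
      unfold embedRun
      rw [hω]
    rw [lintegral_congr_ae h1, lintegral_congr_ae h2]
    simp
  | succ n ih =>
    have hup : ∀ (ω : ℕ → RunEntry A (Option S)), K ω =
        K (Function.update ω (n + 1) (ω (n + 1))) := fun ω => by rw [Function.update_eq_self]
    have hcongr : ∀ (ω ω' : ℕ → RunEntry A (Option S)) e, (∀ k ≤ n, ω k = ω' k) →
        K (Function.update ω (n + 1) e) = K (Function.update ω' (n + 1) e) := by
      intro ω ω' e h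
      refine hK _ _ fun k hk => ?_
      rcases hk.eq_or_lt with rfl | hk
      · simp
      · rw [Function.update_of_ne hk.ne, Function.update_of_ne hk.ne, h k (Nat.lt_succ_iff.1 hk)]
    have hemb : ∀ (ω : ℕ → RunEntry A S) (e : RunEntry A S),
        embedRun (Function.update ω (n + 1) e) =
          Function.update (embedRun ω) (n + 1) (embedEntry e) := by
      intro ω e
      funext k
      by_cases hk : k = n + 1
      · subst hk; simp [embedRun]
      · simp [embedRun, Function.update_of_ne hk]
    calc ∫⁻ ω, K ω ∂f.runLaw (some s)
        = ∫⁻ ω, K (Function.update ω (n + 1) (ω (n + 1))) ∂f.runLaw (some s) :=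
          lintegral_congr hup
      _ = ∫⁻ ω, ∑' e, f.nextLaw ω n e * K (Function.update ω (n + 1) e) ∂f.runLaw (some s) :=
          f.lintegral_step (some s) n (fun ω e => K (Function.update ω (n + 1) e)) hcongr
      _ = ∫⁻ ω, P.weight ζ n ω * ∑' e, f.nextLaw (embedRun ω) n e *
            K (Function.update (embedRun ω) (n + 1) e) ∂(P.restrict ζ f).runLaw s := by
          -- Averaged over entry `n + 1`, `K` depends on the entries up to `n` only, and it still
          -- vanishes once `t` has been visited.
          refine ih _ (fun ω ω' h => ?_) (fun ω h => ?_)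
          · refine tsum_congr fun e => ?_
            rw [f.nextLaw_congr h, hcongr ω ω' e h]
          · obtain ⟨k, hk, hk0⟩ := h
            refine ENNReal.tsum_eq_zero.2 fun e => mul_eq_zero_of_right _ (hK0 _ ?_)
            exact ⟨k, hk.trans n.le_succ, by
              rw [Function.update_of_ne (Nat.lt_succ_of_le hk).ne, hk0]⟩
      _ = ∫⁻ ω, ∑' e, (P.restrict ζ f).nextLaw ω n e * (P.weight ζ n ω *
            P.entryWeight ζ (ω n).2 e * K (embedRun (Function.update ω (n + 1) e)))
            ∂(P.restrict ζ f).runLaw s := by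
          refine lintegral_congr_ae ?_
          filter_upwards [(P.restrict ζ f).ae_isRunUpTo s] with ω hω
          -- Entries at `t` contribute nothing because `K` vanishes there, so the sum may run over
          -- embedded entries only.
          rw [← embedEntry_injective.tsum_eq, ← ENNReal.tsum_mul_left]
          · refine tsum_congr fun e => ?_
            rw [hemb, P.nextLaw_embedRun ζ f (hω n) e]
            ring
          · rintro ⟨o, _ | y⟩ he
            · refine absurd (mul_eq_zero_of_right _ (hK0 _ ⟨n + 1, le_rfl, ?_⟩)) he
              exact congrArg (fun e : RunEntry A (Option S) => e.2)
                (Function.update_self (β := fun _ => RunEntry A (Option S)) (n + 1) _ _)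
            · exact ⟨((o, y) : RunEntry A S), rfl⟩
      _ = ∫⁻ ω, P.weight ζ n ω * P.entryWeight ζ (ω n).2 (ω (n + 1)) *
            K (embedRun (Function.update ω (n + 1) (ω (n + 1)))) ∂(P.restrict ζ f).runLaw s := by
          refine ((P.restrict ζ f).lintegral_step s n (fun ω e => P.weight ζ n ω *
            P.entryWeight ζ (ω n).2 e * K (embedRun (Function.update ω (n + 1) e))) ?_).symm
          intro ω ω' e h
          rw [P.weight_congr ζ h, h n le_rfl, hemb, hemb,
            hcongr (embedRun ω) (embedRun ω') _ fun k hk => congrArg embedEntry (h k hk)]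
      _ = _ := by
          refine lintegral_congr fun ω => ?_
          rw [weight_succ, Function.update_eq_self]

theorem runLaw_forall_ne_none [Countable S] [Countable A] (ζ : Set.Ioo (0 : ℝ) 1)
    (f : (P.reachMDP ζ).Strategy) (s : S) (n : ℕ) :
    f.runLaw (some s) {ω | ∀ k ≤ n, (ω k).2 ≠ none} =
      ∫⁻ ω, P.weight ζ n ω ∂(P.restrict ζ f).runLaw s := by
  classical
  have hc : ∀ ω ω' : ℕ → RunEntry A (Option S), (∀ k ≤ n, ω k = ω' k) →
      ((∀ k ≤ n, (ω k).2 ≠ none) ↔ ∀ k ≤ n, (ω' k).2 ≠ none) := by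
    intro ω ω' h
    refine forall₂_congr fun k hk => ?_
    rw [h k hk]
  have hm : MeasurableSet {ω : ℕ → RunEntry A (Option S) | ∀ k ≤ n, (ω k).2 ≠ none} :=
    measurableSet_setOfPred.2 (MDP.measurable_of_prefix n _ fun ω ω' h => propext (hc ω ω' h))
  rw [← lintegral_indicator_one hm, P.lintegral_weight_mul ζ f s n]
  · refine lintegral_congr fun ω => ?_
    rw [Set.indicator_of_mem, Pi.one_apply, mul_one]
    intro k _
    exact Option.some_ne_none _
  · intro ω ω' h
    simp only [Set.indicator_apply, Set.mem_ofPred_eq, hc ω ω' h, Pi.one_apply]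
  · rintro ω ⟨k, hk, hk0⟩
    refine Set.indicator_of_notMem (fun h => ?_) _
    rw [Set.mem_ofPred_eq] at h
    exact h k hk hk0

/-- The target is missed with probability `E[ζ ^ N]`, where `N` is the number of accepting
transitions in a run of the original MDP. -/
theorem runLaw_reach_add [Countable S] [Countable A] (ζ : Set.Ioo (0 : ℝ) 1)
    (f : (P.reachMDP ζ).Strategy) (s : S) :
    f.runLaw (some s) {ω | ∃ n, (ω n).2 = none} +
      ∫⁻ ω, ⨅ n, P.weight ζ n ω ∂(P.restrict ζ f).runLaw s = 1 := by
  have hm : ∀ n, MeasurableSet {ω : ℕ → RunEntry A (Option S) | ∀ k ≤ n, (ω k).2 ≠ none} := by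
    intro n
    refine measurableSet_setOfPred.2 (MDP.measurable_of_prefix n _ fun ω ω' h => propext ?_)
    refine forall₂_congr fun k hk => ?_
    rw [h k hk]
  have hcompl : {ω : ℕ → RunEntry A (Option S) | ∃ n, (ω n).2 = none}ᶜ =
      ⋂ n, {ω | ∀ k ≤ n, (ω k).2 ≠ none} := by
    ext ω
    simp only [Set.mem_compl_iff, Set.mem_ofPred_eq, not_exists, Set.mem_iInter]
    exact ⟨fun h n k _ => h k, fun h n => h n n le_rfl⟩
  have hmeas : MeasurableSet {ω : ℕ → RunEntry A (Option S) | ∃ n, (ω n).2 = none} := by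
    rw [← MeasurableSet.compl_iff, hcompl]
    exact MeasurableSet.iInter hm
  have h1 : f.runLaw (some s) {ω | ∃ n, (ω n).2 = none}ᶜ =
      ∫⁻ ω, ⨅ n, P.weight ζ n ω ∂(P.restrict ζ f).runLaw s := by
    -- Continuity from above on the side of `M^ζ` matches monotone convergence of the weights on the
    -- side of the product.
    rw [hcompl, Antitone.measure_iInter, lintegral_iInf (fun n => P.measurable_weight ζ n)]
    · simp only [P.runLaw_forall_ne_none ζ f s]
    · exact fun m n hmn ω => P.weight_antitone ζ ω hmn
    · simp [weight_zero]
    · exact fun m n hmn ω h k hk => h k (hk.trans hmn)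
    · exact fun n => (hm n).nullMeasurableSet
    · exact ⟨0, measure_ne_top _ _⟩
  rw [← h1, measure_add_measure_compl hmeas, measure_univ]

/-! ### Reachability and total reward -/

/-- Reward of the next entry of a run of `M^ζ` in state `o`. -/
noncomputable def entryReward (ζ : Set.Ioo (0 : ℝ) 1) (o : Option S) (e : RunEntry A (Option S)) :
    ℝ≥0∞ :=
  e.1.elim 0 fun a => (P.rewardMDP ζ).reward o a e.2

/-- With `α` the total probability of the accepting transitions, staying in the product contributes
`ζα` to the expected reward and moving to `t` contributes `(1 - ζ)α`. The sum is `α`, and `t` has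
probability `(1 - ζ)α`. -/
theorem tsum_reachMDP_prob_reward (ζ : Set.Ioo (0 : ℝ) 1) (x : S) (a : A) :
    ENNReal.ofReal (1 - ζ) *
      ∑' o, (P.reachMDP ζ).prob (some x) a o * (P.rewardMDP ζ).reward (some x) a o =
    (P.reachMDP ζ).prob (some x) a none := by
  classical
  have hsum : ENNReal.ofReal ζ + ENNReal.ofReal (1 - ζ) = 1 := by
    rw [← ENNReal.ofReal_add ζ.2.1.le (by linarith [ζ.2.2])]; simp
  rw [tsum_option_ennreal]
  have h1 : ∀ y, (P.reachMDP ζ).prob (some x) a (some y) *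
      (P.rewardMDP ζ).reward (some x) a (some y) =
      ENNReal.ofReal ζ * if (x, a, y) ∈ P.acc then P.toMDP.prob x a y else 0 := by
    intro y
    rw [reachMDP_prob_some]
    change _ * P.acc.indicator 1 (x, a, y) = _
    unfold transWeight
    by_cases h : (x, a, y) ∈ P.acc <;> simp [h]
  have h2 : (P.rewardMDP ζ).reward (some x) a none = 1 := rfl
  have h3 : (P.reachMDP ζ).prob (some x) a none =
      ENNReal.ofReal (1 - ζ) * ∑' y, if (x, a, y) ∈ P.acc then P.toMDP.prob x a y else 0 := by
    rw [reachMDP_prob_none, ← ENNReal.tsum_mul_left]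
    refine tsum_congr fun y => ?_
    split_ifs <;> simp
  simp only [h1, h2, mul_one]
  rw [ENNReal.tsum_mul_left, h3, ← add_mul, hsum, one_mul]

theorem ofReal_mul_lintegral_entryReward [Countable S] [Countable A] (ζ : Set.Ioo (0 : ℝ) 1)
    (f : (P.reachMDP ζ).Strategy) (o : Option S) (n : ℕ) :
    ENNReal.ofReal (1 - ζ) * ∫⁻ ω, P.entryReward ζ (ω n).2 (ω (n + 1)) ∂f.runLaw o =
      f.runLaw o {ω | (ω n).2 ≠ none ∧ (ω (n + 1)).2 = none} := by
  classical
  have hm : MeasurableSet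
      {ω : ℕ → RunEntry A (Option S) | (ω n).2 ≠ none ∧ (ω (n + 1)).2 = none} := by
    refine measurableSet_setOfPred.2 (MDP.measurable_of_prefix (n + 1) _ fun ω ω' h => ?_)
    rw [h n n.le_succ, h (n + 1) le_rfl]
  rw [← lintegral_indicator_one hm]
  have e1 := f.lintegral_step o n (fun ω e => P.entryReward ζ (ω n).2 e)
    (fun ω ω' e h => by rw [h n le_rfl])
  have e2 := f.lintegral_step o n
    (fun ω e => if (ω n).2 ≠ none ∧ e.2 = none then 1 else 0) (fun ω ω' e h => by rw [h n le_rfl])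
  simp only [Set.indicator_apply, Set.mem_ofPred_eq, Pi.one_apply]
  rw [e1, e2, ← lintegral_const_mul' _ _ ENNReal.ofReal_ne_top]
  refine lintegral_congr_ae ?_
  filter_upwards [f.ae_isRunUpTo o] with ω hω
  by_cases hn : ((P.reachMDP ζ).avail (ω n).2).Nonempty
  · rw [f.tsum_nextLaw_of_nonempty (hω n) hn, f.tsum_nextLaw_of_nonempty (hω n) hn]
    rw [← ENNReal.tsum_mul_left]
    refine tsum_congr fun a => ?_
    rw [mul_left_comm]
    congr 1
    rcases h : (ω n).2 with _ | x
    · rw [h] at hn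
      exact absurd hn (P.not_nonempty_avail_none ζ)
    · refine (P.tsum_reachMDP_prob_reward ζ x a).trans ?_
      rw [tsum_option_ennreal]
      simp
  · rw [f.tsum_nextLaw_of_not_nonempty (hω n) hn, f.tsum_nextLaw_of_not_nonempty (hω n) hn]
    rw [if_neg fun h => h.1 h.2]
    exact mul_zero _

theorem ae_none_absorbing [Countable S] [Countable A] (ζ : Set.Ioo (0 : ℝ) 1)
    (f : (P.reachMDP ζ).Strategy) (o : Option S) :
    ∀ᵐ ω ∂f.runLaw o, ∀ m n, m ≤ n → (ω m).2 = none → (ω n).2 = none := by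
  classical
  filter_upwards [f.ae_isRunUpTo o, ae_all_iff.2 (f.ae_step o)] with ω hω hs m n hmn hm
  induction n, hmn using Nat.le_induction with
  | base => exact hm
  | succ n _ ih =>
    have hn : ¬ ((P.reachMDP ζ).avail (ω n).2).Nonempty := by
      rw [ih]; exact P.not_nonempty_avail_none ζ
    have h1 := hs n
    rw [f.nextLaw_of_not_nonempty (hω n) hn] at h1
    by_contra hc
    refine h1 ((PMF.pure_apply _ _).trans (if_neg fun h => hc ?_))
    rw [h]
    exact ih

/-- Starting outside `t`, reaching it means entering it at some step. As `t` is absorbing, these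
events are disjoint for different times, and each has `1 - ζ` times the expected reward of its step
as probability. -/
theorem preach_eq [Countable S] [Countable A] (ζ : Set.Ioo (0 : ℝ) 1)
    (f : (P.reachMDP ζ).Strategy) :
    P.preach ζ f = ENNReal.ofReal (1 - ζ) * P.etotal ζ f := by
  classical
  have hmr : ∀ n, Measurable fun ω : ℕ → RunEntry A (Option S) =>
      P.entryReward ζ (ω n).2 (ω (n + 1)) := fun n =>
    MDP.measurable_of_prefix (n + 1) _ fun ω ω' h => by rw [h n n.le_succ, h (n + 1) le_rfl]
  have h1 : P.etotal ζ f =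
      ∑' n, ∫⁻ ω, P.entryReward ζ (ω n).2 (ω (n + 1)) ∂f.runLaw (some P.init) := by
    rw [← lintegral_tsum fun n => (hmr n).aemeasurable]
    refine lintegral_congr fun ω => tsum_congr fun n => ?_
    unfold transition entryReward
    cases (ω (n + 1)).1 <;> rfl
  rw [h1, ← ENNReal.tsum_mul_left]
  simp only [P.ofReal_mul_lintegral_entryReward ζ f]
  rw [← measure_iUnion₀]
  · refine measure_congr ?_
    filter_upwards [f.ae_zero (some P.init)] with ω h0
    refine propext ⟨?_, ?_⟩
    · intro h
      have hex : ∃ n, (ω n).2 = none := h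
      -- The first visit to `t` is not at time `0`, so it has a predecessor outside `t`.
      have hne : Nat.find hex ≠ 0 := by
        intro hz
        have := Nat.find_spec hex
        rw [hz, h0] at this
        exact Option.some_ne_none _ this
      obtain ⟨m, hm⟩ := Nat.exists_eq_succ_of_ne_zero hne
      refine Set.mem_iUnion.2 ⟨m, Nat.find_min hex (by omega), ?_⟩
      have := Nat.find_spec hex
      rwa [hm] at this
    · intro h
      obtain ⟨n, hn⟩ := Set.mem_iUnion.1 h
      exact ⟨n + 1, hn.2⟩
  · have key : ∀ m n, m < n → AEDisjoint (f.runLaw (some P.init))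
        {ω | (ω m).2 ≠ none ∧ (ω (m + 1)).2 = none}
        {ω | (ω n).2 ≠ none ∧ (ω (n + 1)).2 = none} := by
      intro m n hmn
      refine measure_eq_zero_iff_ae_notMem.2 ?_
      filter_upwards [P.ae_none_absorbing ζ f (some P.init)] with ω hω h
      exact h.2.1 (hω (m + 1) n hmn h.1.2)
    intro m n hmn
    rcases lt_or_gt_of_ne hmn with h | h
    · exact key m n h
    · exact (key n m h).symm
  · intro n
    refine MeasurableSet.nullMeasurableSet (measurableSet_setOfPred.2
      (MDP.measurable_of_prefix (n + 1) _ fun ω ω' h => ?_))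
    rw [h n n.le_succ, h (n + 1) le_rfl]

theorem preach_add [Countable S] [Countable A] (ζ : Set.Ioo (0 : ℝ) 1)
    (f : (P.reachMDP ζ).Strategy) :
    P.preach ζ f + ∫⁻ ω, ⨅ n, P.weight ζ n ω ∂(P.restrict ζ f).runLaw P.init = 1 :=
  P.runLaw_reach_add ζ f P.init

theorem etotal_eq [Countable S] [Countable A] (ζ : Set.Ioo (0 : ℝ) 1)
    (f : (P.reachMDP ζ).Strategy) :
    P.etotal ζ f = ENNReal.ofReal (1 / (1 - ζ)) * P.preach ζ f := by
  have h : 0 < 1 - (ζ : ℝ) := by linarith [ζ.2.2]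
  rw [preach_eq, ← mul_assoc, ← ENNReal.ofReal_mul (by positivity), one_div_mul_cancel h.ne',
    ENNReal.ofReal_one, one_mul]

theorem preach_le_one [Countable S] [Countable A] (ζ : Set.Ioo (0 : ℝ) 1)
    (f : (P.reachMDP ζ).Strategy) : P.preach ζ f ≤ 1 :=
  le_self_add.trans (P.preach_add ζ f).le

theorem measurableSet_iInf_weight [Countable S] [Countable A] (ζ : Set.Ioo (0 : ℝ) 1) :
    MeasurableSet {ω | ⨅ n, P.weight ζ n ω = 0} :=
  (Measurable.iInf fun n => P.measurable_weight ζ n) (measurableSet_singleton 0)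

theorem psat_eq [Finite S] [Finite A] (ζ : Set.Ioo (0 : ℝ) 1) (g : P.toMDP.Strategy) :
    P.psat g = g.runLaw P.init {ω | ⨅ n, P.weight ζ n ω = 0} := by
  unfold psat
  simp only [P.iInf_weight_eq_zero_iff ζ]

/-- Both sides say that the nonnegative variable `ζ ^ N` has mean `0`. -/
theorem psat_eq_one_iff [Finite S] [Finite A] (ζ : Set.Ioo (0 : ℝ) 1)
    (f : (P.reachMDP ζ).Strategy) :
    P.psat (P.restrict ζ f) = 1 ↔ P.etotal ζ f = ENNReal.ofReal (1 / (1 - ζ)) := by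
  have hpos : 0 < 1 / (1 - (ζ : ℝ)) := one_div_pos.2 (by linarith [ζ.2.2])
  have h1 : P.etotal ζ f = ENNReal.ofReal (1 / (1 - ζ)) ↔ P.preach ζ f = 1 := by
    rw [etotal_eq]
    nth_rw 2 [← mul_one (ENNReal.ofReal (1 / (1 - (ζ : ℝ))))]
    exact ENNReal.mul_right_inj (ENNReal.ofReal_pos.2 hpos).ne' ENNReal.ofReal_ne_top
  have hI := P.preach_add ζ f
  have h2 : P.preach ζ f = 1 ↔
      ∫⁻ ω, ⨅ n, P.weight ζ n ω ∂(P.restrict ζ f).runLaw P.init = 0 := by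
    constructor
    · intro h
      rw [h] at hI
      exact (ENNReal.add_right_inj ENNReal.one_ne_top).1 (hI.trans (add_zero 1).symm)
    · intro h
      rwa [h, add_zero] at hI
  rw [h1, h2, lintegral_eq_zero_iff (Measurable.iInf fun n => P.measurable_weight ζ n),
    P.psat_eq ζ, prob_compl_eq_zero_iff (P.measurableSet_iInf_weight ζ) |>.symm]
  rfl

/-! ### Value iteration for the probability of missing the target -/

/-- Weighted mean of `φ` after one step. -/
noncomputable def bellman (ζ : Set.Ioo (0 : ℝ) 1) (φ : S → ℝ≥0∞) (x : S) (a : A) : ℝ≥0∞ :=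
  ∑' y, P.toMDP.prob x a y * (P.transWeight ζ x a y * φ y)

open Classical in
/-- The least probability of missing the target of `M^ζ` within `n` steps. -/
noncomputable def missValue (ζ : Set.Ioo (0 : ℝ) 1) : ℕ → S → ℝ≥0∞
  | 0 => fun _ => 1
  | n + 1 => fun x =>
    if (P.toMDP.avail x).Nonempty then ⨅ a ∈ P.toMDP.avail x, P.bellman ζ (missValue ζ n) x a
    else missValue ζ n x

theorem missValue_succ_of_nonempty (ζ : Set.Ioo (0 : ℝ) 1) (n : ℕ) {x : S}
    (h : (P.toMDP.avail x).Nonempty) : P.missValue ζ (n + 1) x =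
      ⨅ a ∈ P.toMDP.avail x, P.bellman ζ (P.missValue ζ n) x a :=
  if_pos h

theorem missValue_succ_of_not_nonempty (ζ : Set.Ioo (0 : ℝ) 1) (n : ℕ) {x : S}
    (h : ¬ (P.toMDP.avail x).Nonempty) : P.missValue ζ (n + 1) x = P.missValue ζ n x :=
  if_neg h

/-- The limit of value iteration. -/
noncomputable def missLimit (ζ : Set.Ioo (0 : ℝ) 1) (x : S) : ℝ≥0∞ := ⨅ n, P.missValue ζ n x

theorem tsum_prob_mul_le {x : S} {a : A} {φ : S → ℝ≥0∞} {c : ℝ≥0∞} (h : ∀ y, φ y ≤ c) :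
    ∑' y, P.toMDP.prob x a y * φ y ≤ c := by
  by_cases ha : a ∈ P.toMDP.avail x
  · calc ∑' y, P.toMDP.prob x a y * φ y ≤ ∑' y, P.toMDP.prob x a y * c :=
        ENNReal.tsum_le_tsum fun y => mul_le_mul_right (h y) _
      _ = c := by rw [ENNReal.tsum_mul_right, MDP.tsum_prob ha, one_mul]
  · simp [MDP.prob_of_notMem ha]

theorem bellman_mono (ζ : Set.Ioo (0 : ℝ) 1) {φ ψ : S → ℝ≥0∞} (h : ∀ y, φ y ≤ ψ y) (x : S)
    (a : A) : P.bellman ζ φ x a ≤ P.bellman ζ ψ x a :=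
  ENNReal.tsum_le_tsum fun y => mul_le_mul_right (mul_le_mul_right (h y) _) _

theorem bellman_le_one (ζ : Set.Ioo (0 : ℝ) 1) {φ : S → ℝ≥0∞} (h : ∀ y, φ y ≤ 1) (x : S)
    (a : A) : P.bellman ζ φ x a ≤ 1 :=
  P.tsum_prob_mul_le fun y => mul_le_one' (P.transWeight_le_one ..) (h y)

theorem missValue_le_one (ζ : Set.Ioo (0 : ℝ) 1) (n : ℕ) (x : S) : P.missValue ζ n x ≤ 1 := by
  induction n generalizing x with
  | zero => exact le_rfl
  | succ n ih =>
    unfold missValue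
    split_ifs with h
    · obtain ⟨a, ha⟩ := h
      exact (iInf₂_le a ha).trans (P.bellman_le_one ζ ih x a)
    · exact ih x

theorem missValue_succ_le (ζ : Set.Ioo (0 : ℝ) 1) (n : ℕ) (x : S) :
    P.missValue ζ (n + 1) x ≤ P.missValue ζ n x := by
  induction n generalizing x with
  | zero => exact P.missValue_le_one ζ 1 x
  | succ n ih =>
    by_cases h : (P.toMDP.avail x).Nonempty
    · rw [P.missValue_succ_of_nonempty ζ _ h, P.missValue_succ_of_nonempty ζ _ h]
      exact iInf₂_mono fun a _ => P.bellman_mono ζ ih x a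
    · exact (P.missValue_succ_of_not_nonempty ζ _ h).le

theorem missValue_antitone (ζ : Set.Ioo (0 : ℝ) 1) (x : S) :
    Antitone fun n => P.missValue ζ n x :=
  antitone_nat_of_succ_le fun n => P.missValue_succ_le ζ n x

theorem missLimit_le_one (ζ : Set.Ioo (0 : ℝ) 1) (x : S) : P.missLimit ζ x ≤ 1 :=
  (iInf_le _ 0).trans (P.missValue_le_one ζ 0 x)

theorem transWeight_mono {ζ ζ' : Set.Ioo (0 : ℝ) 1} (h : ζ ≤ ζ') (x : S) (a : A) (y : S) :
    P.transWeight ζ x a y ≤ P.transWeight ζ' x a y := by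
  unfold transWeight
  split_ifs
  · exact ENNReal.ofReal_le_ofReal h
  · exact le_rfl

theorem missValue_mono {ζ ζ' : Set.Ioo (0 : ℝ) 1} (h : ζ ≤ ζ') (n : ℕ) (x : S) :
    P.missValue ζ n x ≤ P.missValue ζ' n x := by
  induction n generalizing x with
  | zero => exact le_rfl
  | succ n ih =>
    by_cases hx : (P.toMDP.avail x).Nonempty
    · rw [P.missValue_succ_of_nonempty ζ _ hx, P.missValue_succ_of_nonempty ζ' _ hx]
      exact iInf₂_mono fun a _ => ENNReal.tsum_le_tsum fun y =>
        mul_le_mul_right (mul_le_mul' (P.transWeight_mono h x a y) (ih y)) _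
    · rw [P.missValue_succ_of_not_nonempty ζ _ hx, P.missValue_succ_of_not_nonempty ζ' _ hx]
      exact ih x

theorem missLimit_mono (x : S) : Monotone fun ζ => P.missLimit ζ x := fun _ _ h =>
  iInf_mono fun n => P.missValue_mono h n x

theorem tendsto_tsum_prob_mul [Finite S] {ι : Type*} {l : Filter ι} {φ : ι → S → ℝ≥0∞}
    {ψ : S → ℝ≥0∞} (x : S) (a : A)
    (h : ∀ y, Filter.Tendsto (fun i => φ i y) l (nhds (ψ y))) :
    Filter.Tendsto (fun i => ∑' y, P.toMDP.prob x a y * φ i y) l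
      (nhds (∑' y, P.toMDP.prob x a y * ψ y)) := by
  have := Fintype.ofFinite S
  simp only [tsum_fintype]
  refine tendsto_finsetSum _ fun y _ => ENNReal.Tendsto.const_mul (h y) (Or.inr ?_)
  by_cases ha : a ∈ P.toMDP.avail x
  · exact ((ENNReal.le_tsum y).trans_lt ((MDP.tsum_prob ha).trans_lt ENNReal.one_lt_top)).ne
  · simp [MDP.prob_of_notMem ha]

/-- Passage to the limit in value iteration through a finite sum. This half of the optimality
equation is the one that makes the weighted value a submartingale under every strategy. -/
theorem missLimit_le_bellman [Finite S] (ζ : Set.Ioo (0 : ℝ) 1) {x : S} {a : A}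
    (ha : a ∈ P.toMDP.avail x) : P.missLimit ζ x ≤ P.bellman ζ (P.missLimit ζ) x a := by
  refine ge_of_tendsto' (x := Filter.atTop) (f := fun n => P.bellman ζ (P.missValue ζ n) x a)
    (P.tendsto_tsum_prob_mul x a fun y => ?_) fun n => ?_
  · exact ENNReal.Tendsto.const_mul (tendsto_atTop_iInf (P.missValue_antitone ζ y))
      (Or.inr ((P.transWeight_le_one ζ x a y).trans_lt ENNReal.one_lt_top).ne)
  · refine (iInf_le _ (n + 1)).trans ?_
    rw [P.missValue_succ_of_nonempty ζ n ⟨a, ha⟩]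
    exact iInf₂_le a ha

/-- The supremum over `ζ` of the least probability of missing the target. -/
noncomputable def missSup (x : S) : ℝ≥0∞ := ⨆ ζ, P.missLimit ζ x

theorem missSup_le_one (x : S) : P.missSup x ≤ 1 := iSup_le fun ζ => P.missLimit_le_one ζ x

theorem tendsto_coe_Ioo_atTop :
    Filter.Tendsto (fun ζ : Set.Ioo (0 : ℝ) 1 => (ζ : ℝ)) Filter.atTop (nhds 1) :=
  (map_coe_Ioo_atTop (zero_lt_one' ℝ)).le.trans nhdsWithin_le_nhds

/-- For `ζ` close to `1`, optimal actions conserve the limit value. -/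
theorem exists_forall_conserving [Finite S] [Finite A] :
    ∃ ζ₀ : Set.Ioo (0 : ℝ) 1, ∀ ζ, ζ₀ ≤ ζ → ∀ x a,
      P.bellman ζ (P.missLimit ζ) x a ≤ P.missLimit ζ x →
      ∑' y, P.toMDP.prob x a y * P.missSup y ≤ P.missSup x := by
  have : Nonempty (Set.Ioo (0 : ℝ) 1) := ⟨⟨1 / 2, by norm_num, by norm_num⟩⟩
  rw [← Filter.eventually_atTop]
  -- There are finitely many pairs `(x, a)`, so a threshold for each pair yields a common one.
  refine Filter.eventually_all.2 fun x => Filter.eventually_all.2 fun a => ?_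
  by_cases h : ∑' y, P.toMDP.prob x a y * P.missSup y ≤ P.missSup x
  · exact Filter.Eventually.of_forall fun _ _ => h
  -- If `a` strictly increases the limit value on average, then, as the factors tend to `1`, its
  -- Bellman value eventually exceeds `missSup x` and hence `missLimit ζ x`: for such `ζ` the action
  -- is not optimal.
  · have ht : Filter.Tendsto (fun ζ => P.bellman ζ (P.missLimit ζ) x a) Filter.atTop
        (nhds (∑' y, P.toMDP.prob x a y * P.missSup y)) := by
      refine P.tendsto_tsum_prob_mul x a fun y => ?_
      have h1 : Filter.Tendsto (fun ζ => P.transWeight ζ x a y) Filter.atTop (nhds 1) := by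
        unfold transWeight
        split_ifs
        · simpa using ENNReal.tendsto_ofReal tendsto_coe_Ioo_atTop
        · exact tendsto_const_nhds
      have h2 := ENNReal.Tendsto.mul h1 (Or.inl one_ne_zero)
        (tendsto_atTop_iSup (P.missLimit_mono y)) (Or.inr ENNReal.one_ne_top)
      rwa [one_mul] at h2
    filter_upwards [ht.eventually_const_lt (not_le.1 h)] with ζ hζ h'
    exact absurd (hζ.trans_le h') (not_lt.2 (le_iSup (fun ζ => P.missLimit ζ x) ζ))

/-! ### Weighted expectations under a strategy -/

theorem lintegral_weight_succ [Countable S] [Countable A] (ζ : Set.Ioo (0 : ℝ) 1)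
    (g : P.toMDP.Strategy) (s : S) (n : ℕ) (φ : S → ℝ≥0∞) :
    ∫⁻ ω, P.weight ζ (n + 1) ω * φ (ω (n + 1)).2 ∂g.runLaw s =
      ∫⁻ ω, P.weight ζ n ω *
        ∑' e, g.nextLaw ω n e * (P.entryWeight ζ (ω n).2 e * φ e.2) ∂g.runLaw s := by
  simp only [weight_succ, mul_assoc]
  refine (g.lintegral_step s n
    (fun ω e => P.weight ζ n ω * (P.entryWeight ζ (ω n).2 e * φ e.2)) ?_).trans ?_
  · intro ω ω' e h
    rw [P.weight_congr ζ h, h n le_rfl]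
  · refine lintegral_congr fun ω => ?_
    rw [← ENNReal.tsum_mul_left]
    exact tsum_congr fun e => mul_left_comm _ _ _

theorem tsum_nextLaw_weight_of_nonempty (ζ : Set.Ioo (0 : ℝ) 1) (g : P.toMDP.Strategy)
    {ω : ℕ → RunEntry A S} {n : ℕ} (h : P.toMDP.IsRunUpTo ω n)
    (hn : (P.toMDP.avail (ω n).2).Nonempty) (φ : S → ℝ≥0∞) :
    ∑' e, g.nextLaw ω n e * (P.entryWeight ζ (ω n).2 e * φ e.2) =
      ∑' a, g.choose (h.decisionRun hn) a * P.bellman ζ φ (ω n).2 a :=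
  g.tsum_nextLaw_of_nonempty h hn fun e => P.entryWeight ζ (ω n).2 e * φ e.2

theorem tsum_nextLaw_weight_of_not_nonempty (ζ : Set.Ioo (0 : ℝ) 1) (g : P.toMDP.Strategy)
    {ω : ℕ → RunEntry A S} {n : ℕ} (h : P.toMDP.IsRunUpTo ω n)
    (hn : ¬ (P.toMDP.avail (ω n).2).Nonempty) (φ : S → ℝ≥0∞) :
    ∑' e, g.nextLaw ω n e * (P.entryWeight ζ (ω n).2 e * φ e.2) = φ (ω n).2 :=
  (g.tsum_nextLaw_of_not_nonempty h hn fun e => P.entryWeight ζ (ω n).2 e * φ e.2).trans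
    (one_mul _)

theorem choose_eq_zero_of_notMem (g : P.toMDP.Strategy) {ω : ℕ → RunEntry A S} {n : ℕ}
    (h : P.toMDP.IsRunUpTo ω n) (hn : (P.toMDP.avail (ω n).2).Nonempty) {a : A}
    (ha : a ∉ P.toMDP.avail (ω n).2) : g.choose (h.decisionRun hn) a = 0 := by
  rw [PMF.apply_eq_zero_iff]
  intro h'
  have := g.support_subset _ h'
  have hl : (h.decisionRun hn).1.last = (ω n).2 := h.last
  rw [hl] at this
  exact ha this

theorem choose_mul_le (ζ : Set.Ioo (0 : ℝ) 1) [Finite S] (g : P.toMDP.Strategy)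
    {ω : ℕ → RunEntry A S} {n : ℕ} (h : P.toMDP.IsRunUpTo ω n)
    (hn : (P.toMDP.avail (ω n).2).Nonempty) (a : A) :
    g.choose (h.decisionRun hn) a * P.missLimit ζ (ω n).2 ≤
      g.choose (h.decisionRun hn) a * P.bellman ζ (P.missLimit ζ) (ω n).2 a := by
  by_cases ha : a ∈ P.toMDP.avail (ω n).2
  · exact mul_le_mul_right (P.missLimit_le_bellman ζ ha) _
  · rw [P.choose_eq_zero_of_notMem g h hn ha, zero_mul, zero_mul]

theorem missLimit_le_tsum_nextLaw [Finite S] (ζ : Set.Ioo (0 : ℝ) 1) (g : P.toMDP.Strategy)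
    {ω : ℕ → RunEntry A S} {n : ℕ} (h : P.toMDP.IsRunUpTo ω n) :
    P.missLimit ζ (ω n).2 ≤
      ∑' e, g.nextLaw ω n e * (P.entryWeight ζ (ω n).2 e * P.missLimit ζ e.2) := by
  by_cases hn : (P.toMDP.avail (ω n).2).Nonempty
  · rw [P.tsum_nextLaw_weight_of_nonempty ζ g h hn]
    calc P.missLimit ζ (ω n).2
        = ∑' a, g.choose (h.decisionRun hn) a * P.missLimit ζ (ω n).2 := by
          rw [ENNReal.tsum_mul_right, PMF.tsum_coe, one_mul]
      _ ≤ _ := ENNReal.tsum_le_tsum fun a => P.choose_mul_le ζ g h hn a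
  · rw [P.tsum_nextLaw_weight_of_not_nonempty ζ g h hn]

/-- An average of Bellman values, each at least `missLimit`, equals `missLimit` only if every action
of positive probability attains it. -/
theorem bellman_le_of_tsum_nextLaw_eq [Finite S] (ζ : Set.Ioo (0 : ℝ) 1) (g : P.toMDP.Strategy)
    {ω : ℕ → RunEntry A S} {n : ℕ} (h : P.toMDP.IsRunUpTo ω n)
    (hn : (P.toMDP.avail (ω n).2).Nonempty)
    (heq : P.missLimit ζ (ω n).2 =
      ∑' e, g.nextLaw ω n e * (P.entryWeight ζ (ω n).2 e * P.missLimit ζ e.2))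
    {a : A} (ha : g.choose (h.decisionRun hn) a ≠ 0) :
    P.bellman ζ (P.missLimit ζ) (ω n).2 a ≤ P.missLimit ζ (ω n).2 := by
  by_contra hlt
  rw [not_le] at hlt
  rw [P.tsum_nextLaw_weight_of_nonempty ζ g h hn] at heq
  have h1 : ∑' a, g.choose (h.decisionRun hn) a * P.missLimit ζ (ω n).2 =
      P.missLimit ζ (ω n).2 := by
    rw [ENNReal.tsum_mul_right, PMF.tsum_coe, one_mul]
  have h2 := ENNReal.tsum_lt_tsum (i := a) (h1.trans_lt
    ((P.missLimit_le_one ζ _).trans_lt ENNReal.one_lt_top)).ne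
    (fun a => P.choose_mul_le ζ g h hn a)
    (ENNReal.mul_lt_mul_right ha (PMF.apply_ne_top _ _) hlt)
  rw [h1, ← heq] at h2
  exact lt_irrefl _ h2

theorem lintegral_weight_missLimit_mono [Finite S] [Finite A] (ζ : Set.Ioo (0 : ℝ) 1)
    (g : P.toMDP.Strategy) (s : S) :
    Monotone fun n => ∫⁻ ω, P.weight ζ n ω * P.missLimit ζ (ω n).2 ∂g.runLaw s := by
  refine monotone_nat_of_le_succ fun n => ?_
  simp only [P.lintegral_weight_succ ζ g s n (P.missLimit ζ)]
  refine lintegral_mono_ae ?_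
  filter_upwards [g.ae_isRunUpTo s] with ω hω
  exact mul_le_mul_right (P.missLimit_le_tsum_nextLaw ζ g (hω n)) _

theorem lintegral_weight_zero_mul [Countable S] [Countable A] (ζ : Set.Ioo (0 : ℝ) 1)
    (g : P.toMDP.Strategy) (s : S) (φ : S → ℝ≥0∞) :
    ∫⁻ ω, P.weight ζ 0 ω * φ (ω 0).2 ∂g.runLaw s = φ s := by
  have : ∀ᵐ ω ∂g.runLaw s, P.weight ζ 0 ω * φ (ω 0).2 = φ s := by
    filter_upwards [g.ae_zero s] with ω hω
    rw [weight_zero, one_mul, hω]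
  rw [lintegral_congr_ae this]
  simp

theorem missLimit_le_lintegral [Finite S] [Finite A] (ζ : Set.Ioo (0 : ℝ) 1)
    (g : P.toMDP.Strategy) (s : S) (n : ℕ) :
    P.missLimit ζ s ≤ ∫⁻ ω, P.weight ζ n ω * P.missLimit ζ (ω n).2 ∂g.runLaw s := by
  rw [← P.lintegral_weight_zero_mul ζ g s (P.missLimit ζ)]
  exact P.lintegral_weight_missLimit_mono ζ g s n.zero_le

theorem lintegral_iInf_weight [Countable S] [Countable A] (ζ : Set.Ioo (0 : ℝ) 1)
    (g : P.toMDP.Strategy) (s : S) :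
    ∫⁻ ω, ⨅ n, P.weight ζ n ω ∂g.runLaw s = ⨅ n, ∫⁻ ω, P.weight ζ n ω ∂g.runLaw s := by
  refine lintegral_iInf (fun n => P.measurable_weight ζ n)
    (fun m n hmn ω => P.weight_antitone ζ ω hmn) ?_
  simp [weight_zero]

/-- The left side increases with `n`, and at later times it is below the mean weight since the value
is at most `1`. With `n = 0` this bounds the probability of missing `t` from below by `missLimit`.
-/
theorem lintegral_weight_missLimit_le [Finite S] [Finite A] (ζ : Set.Ioo (0 : ℝ) 1)
    (g : P.toMDP.Strategy) (s : S) (n : ℕ) :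
    ∫⁻ ω, P.weight ζ n ω * P.missLimit ζ (ω n).2 ∂g.runLaw s ≤
      ∫⁻ ω, ⨅ n, P.weight ζ n ω ∂g.runLaw s := by
  rw [lintegral_iInf_weight]
  refine le_iInf fun m => ?_
  calc _ ≤ ∫⁻ ω, P.weight ζ (max n m) ω * P.missLimit ζ (ω (max n m)).2 ∂g.runLaw s :=
        P.lintegral_weight_missLimit_mono ζ g s (le_max_left n m)
    _ ≤ _ := lintegral_mono fun ω =>
        (mul_le_of_le_one_right' (P.missLimit_le_one ζ _)).trans
          (P.weight_antitone ζ ω (le_max_right n m))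

/-! ### Optimal strategies for a bounded number of steps -/

theorem exists_bellman_eq [Finite A] (ζ : Set.Ioo (0 : ℝ) 1) (n : ℕ) {x : S}
    (h : (P.toMDP.avail x).Nonempty) :
    ∃ a ∈ P.toMDP.avail x, P.bellman ζ (P.missValue ζ n) x a = P.missValue ζ (n + 1) x := by
  obtain ⟨a, ha, hmin⟩ := Set.exists_min_image _ (P.bellman ζ (P.missValue ζ n) x)
    (Set.toFinite (P.toMDP.avail x)) h
  refine ⟨a, ha, ?_⟩
  rw [P.missValue_succ_of_nonempty ζ n h]
  exact le_antisymm (le_iInf₂ hmin) (iInf₂_le a ha)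

/-- Backward induction: playing the minimiser for the remaining horizon keeps the mean of the weight
times the remaining value constant. -/
theorem exists_strategy_lintegral_eq [Finite S] [Finite A] (ζ : Set.Ioo (0 : ℝ) 1) (n : ℕ)
    (s : S) : ∃ g : P.toMDP.Strategy,
      ∫⁻ ω, P.weight ζ n ω ∂g.runLaw s = P.missValue ζ n s := by
  classical
  choose best hbest hval using fun (k : ℕ) (r : P.toMDP.DecisionRun) =>
    P.exists_bellman_eq ζ k r.2
  -- After `k` steps the minimiser for horizon `n - k` is played; it is indexed by `n - (k + 1)`,
  -- the horizon left after the step. The strategy reads `k` off the length of the run, which is the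
  -- time as long as the computation has not stopped.
  let g : P.toMDP.Strategy := ⟨fun r => PMF.pure (best (n - (r.1.steps.length + 1)) r), fun r => by
    rw [PMF.support_pure, Set.singleton_subset_iff]
    exact hbest _ r⟩
  refine ⟨g, ?_⟩
  have key : ∀ k ≤ n, ∫⁻ ω, P.weight ζ k ω * P.missValue ζ (n - k) (ω k).2 ∂g.runLaw s =
      P.missValue ζ n s := by
    intro k
    induction k with
    | zero => exact fun _ => P.lintegral_weight_zero_mul ζ g s (P.missValue ζ n)
    | succ k ih =>
      intro hk
      rw [← ih (Nat.le_of_succ_le hk), P.lintegral_weight_succ]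
      have hsub : n - k = n - (k + 1) + 1 := by omega
      refine lintegral_congr_ae ?_
      filter_upwards [g.ae_isRunUpTo s] with ω hω
      congr 1
      by_cases hn : (P.toMDP.avail (ω k).2).Nonempty
      · rw [P.tsum_nextLaw_weight_of_nonempty ζ g (hω k) hn]
        have hl : ((hω k).decisionRun hn).1.last = (ω k).2 := (hω k).last
        have hlen : ((hω k).decisionRun hn).1.steps.length = k := (hω k).length hn
        have h1 := hval (n - (k + 1)) ((hω k).decisionRun hn)
        have hch : g.choose ((hω k).decisionRun hn) =
            PMF.pure (best (n - (k + 1)) ((hω k).decisionRun hn)) := by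
          simp only [g, hlen]
        rw [hch, tsum_eq_single (best (n - (k + 1)) ((hω k).decisionRun hn)), PMF.pure_apply,
          if_pos rfl, one_mul, hsub, ← hl]
        · exact h1
        · intro a ha
          rw [PMF.pure_apply, if_neg ha, zero_mul]
      · rw [P.tsum_nextLaw_weight_of_not_nonempty ζ g (hω k) hn, hsub,
          P.missValue_succ_of_not_nonempty ζ _ hn]
  have := key n le_rfl
  simpa [missValue] using this

/-! ### Optimal strategies -/

/-- The Büchi objective has probability at most the limit value. -/
theorem psat_add_missSup_le [Finite S] [Finite A] (g : P.toMDP.Strategy) :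
    P.psat g + P.missSup P.init ≤ 1 := by
  have : Nonempty (Set.Ioo (0 : ℝ) 1) := ⟨⟨1 / 2, by norm_num, by norm_num⟩⟩
  unfold missSup
  rw [ENNReal.add_iSup]
  refine iSup_le fun ζ => ?_
  have h1 : P.missLimit ζ P.init ≤ ∫⁻ ω, ⨅ n, P.weight ζ n ω ∂g.runLaw P.init :=
    (P.missLimit_le_lintegral ζ g P.init 0).trans (P.lintegral_weight_missLimit_le ζ g P.init 0)
  -- `ζ ^ N` is at most the indicator of `N < ∞`.
  have h2 : ∫⁻ ω, ⨅ n, P.weight ζ n ω ∂g.runLaw P.init ≤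
      g.runLaw P.init {ω | ⨅ n, P.weight ζ n ω = 0}ᶜ := by
    rw [← lintegral_indicator_one (P.measurableSet_iInf_weight ζ).compl]
    refine lintegral_mono fun ω => ?_
    by_cases h : ⨅ n, P.weight ζ n ω = 0
    · rw [h]; exact zero_le
    · rw [Set.indicator_of_mem h]
      exact (iInf_le _ 0).trans (P.weight_le_one ζ 0 ω)
  calc P.psat g + P.missLimit ζ P.init
      ≤ g.runLaw P.init {ω | ⨅ n, P.weight ζ n ω = 0} +
        g.runLaw P.init {ω | ⨅ n, P.weight ζ n ω = 0}ᶜ := by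
        rw [P.psat_eq ζ g]
        gcongr
        exact h1.trans h2
    _ = 1 := by rw [measure_add_measure_compl (P.measurableSet_iInf_weight ζ), measure_univ]

/-- A strategy with the largest expected total reward has the least probability of missing the
target. -/
theorem lintegral_iInf_weight_le_of_optimal [Finite S] [Finite A] (ζ : Set.Ioo (0 : ℝ) 1)
    (f : (P.reachMDP ζ).Strategy) (hf : P.etotal ζ f = ⨆ g, P.etotal ζ g) :
    ∫⁻ ω, ⨅ n, P.weight ζ n ω ∂(P.restrict ζ f).runLaw P.init ≤ P.missLimit ζ P.init := by
  refine le_iInf fun n => ?_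
  obtain ⟨g, hg⟩ := P.exists_strategy_lintegral_eq ζ n P.init
  obtain ⟨g, rfl⟩ := (P.restrict_bijective ζ).2 g
  have h1 : P.preach ζ g ≤ P.preach ζ f := by
    rw [preach_eq, preach_eq, hf]
    exact mul_le_mul_right (le_iSup (fun g => P.etotal ζ g) g) _
  have h2 := P.preach_add ζ f
  have h3 := P.preach_add ζ g
  -- Reaching and missing add up to `1` for both strategies, so the one that reaches at least as
  -- often misses at most as often.
  have h4 : P.preach ζ f + ∫⁻ ω, ⨅ n, P.weight ζ n ω ∂(P.restrict ζ f).runLaw P.init ≤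
      P.preach ζ f + ∫⁻ ω, ⨅ n, P.weight ζ n ω ∂(P.restrict ζ g).runLaw P.init := by
    rw [h2, ← h3]
    gcongr
  have h5 := (ENNReal.add_le_add_iff_left
    ((P.preach_le_one ζ f).trans_lt ENNReal.one_lt_top).ne).1 h4
  refine h5.trans (le_of_le_of_eq ?_ hg)
  exact lintegral_mono fun ω => iInf_le _ n

/-- If almost surely only conserving actions are taken, the mean of the limit value does not
increase. -/
theorem lintegral_missSup_le [Finite S] [Finite A] (ζ : Set.Ioo (0 : ℝ) 1)
    (hζ : ∀ x a, P.bellman ζ (P.missLimit ζ) x a ≤ P.missLimit ζ x →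
      ∑' y, P.toMDP.prob x a y * P.missSup y ≤ P.missSup x)
    (g : P.toMDP.Strategy) (s : S)
    (hg : ∫⁻ ω, ⨅ n, P.weight ζ n ω ∂g.runLaw s ≤ P.missLimit ζ s) (n : ℕ) :
    ∫⁻ ω, P.missSup (ω n).2 ∂g.runLaw s ≤ P.missSup s := by
  induction n with
  | zero =>
    have : ∀ᵐ ω ∂g.runLaw s, P.missSup (ω 0).2 = P.missSup s := by
      filter_upwards [g.ae_zero s] with ω hω
      rw [hω]
    rw [lintegral_congr_ae this]
    simp
  | succ n ih =>
    refine le_trans ?_ ih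
    -- The mean of the submartingale is squeezed between its initial value and the probability of
    -- missing the target, so optimality makes it constant.
    have hconst : ∀ n, ∫⁻ ω, P.weight ζ n ω * P.missLimit ζ (ω n).2 ∂g.runLaw s =
        P.missLimit ζ s := fun n =>
      le_antisymm ((P.lintegral_weight_missLimit_le ζ g s n).trans hg)
        (P.missLimit_le_lintegral ζ g s n)
    have hstep := P.lintegral_weight_succ ζ g s n (P.missLimit ζ)
    have hmeas : Measurable fun ω : ℕ → RunEntry A S => P.weight ζ n ω *
        ∑' e, g.nextLaw ω n e * (P.entryWeight ζ (ω n).2 e * P.missLimit ζ e.2) :=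
      MDP.measurable_of_prefix n _ fun ω ω' h => by
        rw [P.weight_congr ζ h, g.nextLaw_congr h, h n le_rfl]
    -- Equal finite means turn the one-step inequality into an almost sure equality; the weight,
    -- being neither `0` nor `∞`, then cancels.
    have hae := ae_eq_of_ae_le_of_lintegral_le
      (f := fun ω => P.weight ζ n ω * P.missLimit ζ (ω n).2)
      (g := fun ω => P.weight ζ n ω *
        ∑' e, g.nextLaw ω n e * (P.entryWeight ζ (ω n).2 e * P.missLimit ζ e.2))
      (μ := g.runLaw s)
      (by
        filter_upwards [g.ae_isRunUpTo s] with ω hω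
        exact mul_le_mul_right (P.missLimit_le_tsum_nextLaw ζ g (hω n)) _)
      (by rw [hconst]; exact ((P.missLimit_le_one ζ s).trans_lt ENNReal.one_lt_top).ne)
      hmeas.aemeasurable (by rw [← hstep, hconst, hconst])
    have h1 : ∫⁻ ω, P.missSup (ω (n + 1)).2 ∂g.runLaw s =
        ∫⁻ ω, ∑' e, g.nextLaw ω n e * P.missSup e.2 ∂g.runLaw s :=
      g.lintegral_step s n (fun _ e => P.missSup e.2) fun _ _ _ _ => rfl
    rw [h1]
    refine lintegral_mono_ae ?_
    filter_upwards [g.ae_isRunUpTo s, hae] with ω hω heq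
    have heq' := (ENNReal.mul_right_inj (P.weight_ne_zero ζ n ω) (P.weight_ne_top ζ n ω)).1 heq
    by_cases hn : (P.toMDP.avail (ω n).2).Nonempty
    · rw [g.tsum_nextLaw_of_nonempty (hω n) hn fun e => P.missSup e.2]
      calc ∑' a, g.choose ((hω n).decisionRun hn) a *
            ∑' y, P.toMDP.prob (ω n).2 a y * P.missSup y
          ≤ ∑' a, g.choose ((hω n).decisionRun hn) a * P.missSup (ω n).2 := by
            refine ENNReal.tsum_le_tsum fun a => ?_
            by_cases ha : g.choose ((hω n).decisionRun hn) a = 0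
            · rw [ha, zero_mul, zero_mul]
            · exact mul_le_mul_right
                (hζ _ _ (P.bellman_le_of_tsum_nextLaw_eq ζ g (hω n) hn heq' ha)) _
        _ = P.missSup (ω n).2 := by rw [ENNReal.tsum_mul_right, PMF.tsum_coe, one_mul]
    · rw [g.tsum_nextLaw_of_not_nonempty (hω n) hn fun e => P.missSup e.2]

theorem measurable_comp_state [Countable S] [Countable A] (φ : S → ℝ≥0∞) (n : ℕ) :
    Measurable fun ω : ℕ → RunEntry A S => φ (ω n).2 :=
  MDP.measurable_of_prefix n _ fun ω ω' h => by rw [h n le_rfl]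

/-- Split `1` into `E[v(Xₙ)]`, at most `v(init)`, and `E[1 - v(Xₙ)]`, where `v` is `missSup`. The
second part vanishes in the limit where the weight stays above a level `c`, and elsewhere it is at
most the probability that `ζ ^ N < c`. Finally `c` tends to `0`. -/
theorem one_le_missSup_add [Finite S] [Finite A] (ζ : Set.Ioo (0 : ℝ) 1)
    (hζ : ∀ x a, P.bellman ζ (P.missLimit ζ) x a ≤ P.missLimit ζ x →
      ∑' y, P.toMDP.prob x a y * P.missSup y ≤ P.missSup x)
    (g : P.toMDP.Strategy)
    (hg : ∫⁻ ω, ⨅ n, P.weight ζ n ω ∂g.runLaw P.init ≤ P.missLimit ζ P.init) :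
    1 ≤ P.missSup P.init + P.psat g := by
  set μ := g.runLaw P.init with hμ
  have hlim_top : P.missLimit ζ P.init ≠ ∞ :=
    ((P.missLimit_le_one ζ _).trans_lt ENNReal.one_lt_top).ne
  -- `E[ζ ^ Nₙ * v_ζ(Xₙ)]` is at least `v_ζ(init)`, and `v_ζ ≤ v` bounds `1 - v + v_ζ` by `1`.
  have hweight : ∀ n, ∫⁻ ω, P.weight ζ n ω * (1 - P.missSup (ω n).2) ∂μ ≤
      ∫⁻ ω, P.weight ζ n ω ∂μ - P.missLimit ζ P.init := by
    intro n
    refine ENNReal.le_sub_of_add_le_right hlim_top ?_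
    calc _ ≤ ∫⁻ ω, P.weight ζ n ω * (1 - P.missSup (ω n).2) ∂μ +
          ∫⁻ ω, P.weight ζ n ω * P.missLimit ζ (ω n).2 ∂μ := by
          gcongr
          exact P.missLimit_le_lintegral ζ g P.init n
      _ = ∫⁻ ω, P.weight ζ n ω * (1 - P.missSup (ω n).2) +
          P.weight ζ n ω * P.missLimit ζ (ω n).2 ∂μ := by
          exact (lintegral_add_right _
            ((P.measurable_weight ζ n).mul (measurable_comp_state (P.missLimit ζ) n))).symm
      _ ≤ _ := by
          refine lintegral_mono fun ω => ?_
          rw [← mul_add]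
          refine mul_le_of_le_one_right' ?_
          calc _ ≤ 1 - P.missSup (ω n).2 + P.missSup (ω n).2 := by
                gcongr
                exact le_iSup (fun ζ => P.missLimit ζ (ω n).2) ζ
            _ = 1 := tsub_add_cancel_of_le (P.missSup_le_one _)
  -- The mean weights decrease to the probability of missing the target, which optimality bounds by
  -- `missLimit`; truncated subtraction then gives the limit `0`.
  have htend : Filter.Tendsto (fun n => ∫⁻ ω, P.weight ζ n ω ∂μ - P.missLimit ζ P.init)
      Filter.atTop (nhds 0) := by
    have h1 : Filter.Tendsto (fun n => ∫⁻ ω, P.weight ζ n ω ∂μ) Filter.atTop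
        (nhds (⨅ n, ∫⁻ ω, P.weight ζ n ω ∂μ)) :=
      tendsto_atTop_iInf fun m n hmn => lintegral_mono fun ω => P.weight_antitone ζ ω hmn
    have h2 := ENNReal.Tendsto.sub h1 (tendsto_const_nhds (x := P.missLimit ζ P.init))
      (Or.inr hlim_top)
    rwa [← P.lintegral_iInf_weight ζ g P.init, tsub_eq_zero_of_le hg] at h2
  have hbound : ∀ c : ℝ≥0∞, c ≠ 0 → c ≠ ∞ →
      1 ≤ P.missSup P.init + μ {ω | ⨅ n, P.weight ζ n ω < c} := by
    intro c hc0 hc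
    have hms : MeasurableSet {ω : ℕ → RunEntry A S | ⨅ n, P.weight ζ n ω < c} :=
      (Measurable.iInf fun n => P.measurable_weight ζ n) measurableSet_Iio
    have hn : ∀ n, 1 ≤ P.missSup P.init + (c⁻¹ *
        (∫⁻ ω, P.weight ζ n ω ∂μ - P.missLimit ζ P.init) +
        μ {ω | ⨅ n, P.weight ζ n ω < c}) := by
      intro n
      calc (1 : ℝ≥0∞) = ∫⁻ _, 1 ∂μ := by simp [hμ]
        _ ≤ ∫⁻ ω, P.missSup (ω n).2 + (c⁻¹ * (P.weight ζ n ω * (1 - P.missSup (ω n).2)) +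
            {ω | ⨅ n, P.weight ζ n ω < c}.indicator 1 ω) ∂μ := by
            refine lintegral_mono fun ω => ?_
            -- It remains to bound `1 - v(Xₙ)`: by the indicator if the limiting weight is below
            -- `c`, and otherwise by `c⁻¹` times its weighted version, as then the weight at time
            -- `n` is at least `c`.
            rw [← add_tsub_cancel_of_le (P.missSup_le_one (ω n).2)]
            gcongr
            rw [add_tsub_cancel_of_le (P.missSup_le_one (ω n).2)]
            by_cases h : ⨅ n, P.weight ζ n ω < c
            · rw [Set.indicator_of_mem (s := {ω | ⨅ n, P.weight ζ n ω < c}) h]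
              exact tsub_le_self.trans le_add_self
            · have h1 : c ≤ P.weight ζ n ω := (not_lt.1 h).trans (iInf_le _ n)
              refine le_add_right ?_
              rw [← mul_assoc]
              refine le_mul_of_one_le_left' ?_
              rw [← ENNReal.inv_mul_cancel hc0 hc]
              gcongr
        _ = ∫⁻ ω, P.missSup (ω n).2 ∂μ +
            (c⁻¹ * ∫⁻ ω, P.weight ζ n ω * (1 - P.missSup (ω n).2) ∂μ +
            μ {ω | ⨅ n, P.weight ζ n ω < c}) := by
            rw [lintegral_add_left (measurable_comp_state _ n),
              lintegral_add_right _ (measurable_one.indicator hms),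
              lintegral_const_mul' _ _ (ENNReal.inv_ne_top.2 hc0), lintegral_indicator_one hms]
        _ ≤ _ := by
            gcongr
            · exact P.lintegral_missSup_le ζ hζ g P.init hg n
            · exact hweight n
    have hlim := (ENNReal.Tendsto.const_mul (a := c⁻¹) htend
      (Or.inr (ENNReal.inv_ne_top.2 hc0))).add_const (μ {ω | ⨅ n, P.weight ζ n ω < c})
    have hlim2 := hlim.const_add (P.missSup P.init)
    rw [mul_zero, zero_add] at hlim2
    exact ge_of_tendsto' hlim2 hn
  have hinter : {ω : ℕ → RunEntry A S | ⨅ n, P.weight ζ n ω = 0} =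
      ⋂ k : ℕ, {ω | ⨅ n, P.weight ζ n ω < ((k : ℝ≥0∞) + 1)⁻¹} := by
    ext ω
    simp only [Set.mem_ofPred_eq, Set.mem_iInter]
    constructor
    · intro h k
      rw [h]
      exact ENNReal.inv_pos.2 (by finiteness)
    · intro h
      by_contra h0
      obtain ⟨k, hk⟩ := ENNReal.exists_inv_nat_lt h0
      exact lt_irrefl _ ((h k).trans ((ENNReal.inv_le_inv.2 le_self_add).trans_lt hk))
  -- The levels `c = 1 / (k + 1)` exhaust the event `ζ ^ N = 0`, and continuity from above passes to
  -- it.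
  rw [P.psat_eq ζ g, hinter, Antitone.measure_iInter, ENNReal.add_iInf]
  · exact le_iInf fun k => hbound _ (by simp) (by simp)
  · intro k l hkl ω h
    refine lt_of_lt_of_le h (ENNReal.inv_le_inv.2 ?_)
    gcongr
  · exact fun k => ((Measurable.iInf fun n => P.measurable_weight ζ n)
      measurableSet_Iio).nullMeasurableSet
  · exact ⟨0, measure_ne_top _ _⟩

/-- For `ζ` close to `1`, strategies with the largest expected total reward maximise the
probability of the Büchi objective. -/
theorem exists_forall_optimal [Finite S] [Finite A] :
    ∃ ζ₀ : Set.Ioo (0 : ℝ) 1, ∀ ζ : Set.Ioo (0 : ℝ) 1, ζ₀ ≤ ζ →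
      ∀ f : (P.reachMDP ζ).Strategy, P.etotal ζ f = ⨆ g, P.etotal ζ g →
        P.psat (P.restrict ζ f) = ⨆ g, P.psat g := by
  obtain ⟨ζ₀, h₀⟩ := P.exists_forall_conserving
  refine ⟨ζ₀, fun ζ hζ f hf => le_antisymm (le_iSup (fun g => P.psat g) _) (iSup_le fun g => ?_)⟩
  have h1 := P.one_le_missSup_add ζ (h₀ ζ hζ) (P.restrict ζ f)
    (P.lintegral_iInf_weight_le_of_optimal ζ f hf)
  have h2 := (P.psat_add_missSup_le g).trans h1
  rw [add_comm] at h2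
  exact (ENNReal.add_le_add_iff_left
    ((P.missSup_le_one _).trans_lt ENNReal.one_lt_top).ne).1 h2

end AccMDP

/-! ### The five claims for the product -/

theorem theorem2 {S A Λ Q : Type*} [Finite S] [Finite A] [Finite Q]
    (M : LabelledMDP S A Λ) (s₀ : S) (B : BuchiAutomaton Λ Q) :
    -- (1)
    (∀ ζ : Set.Ioo (0 : ℝ) 1,
      ((M.product s₀ B).rewardMDP ζ).toMDP = (M.product s₀ B).reachMDP ζ ∧
      Function.Bijective ((M.product s₀ B).restrict ζ)) ∧
    -- (2)
    (∀ (ζ : Set.Ioo (0 : ℝ) 1) (f : ((M.product s₀ B).reachMDP ζ).Strategy),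
      (M.product s₀ B).preach ζ f =
        ENNReal.ofReal (1 - ζ) * (M.product s₀ B).etotal ζ f) ∧
    -- (3)
    (∀ (ζ : Set.Ioo (0 : ℝ) 1) (f : ((M.product s₀ B).reachMDP ζ).Strategy),
      (M.product s₀ B).etotal ζ f ∈ Set.Icc 0 (ENNReal.ofReal (1 / (1 - ζ)))) ∧
    -- (4)
    (∀ (ζ : Set.Ioo (0 : ℝ) 1) (f : ((M.product s₀ B).reachMDP ζ).Strategy),
      (M.product s₀ B).psat ((M.product s₀ B).restrict ζ f) = 1 ↔
        (M.product s₀ B).etotal ζ f = ENNReal.ofReal (1 / (1 - ζ))) ∧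
    -- (5)
    (∃ ζ₀ : Set.Ioo (0 : ℝ) 1, ∀ ζ : Set.Ioo (0 : ℝ) 1, ζ₀ ≤ ζ →
      ∀ f : ((M.product s₀ B).reachMDP ζ).Strategy,
        (M.product s₀ B).etotal ζ f = ⨆ g, (M.product s₀ B).etotal ζ g →
        (M.product s₀ B).psat ((M.product s₀ B).restrict ζ f) =
          ⨆ g, (M.product s₀ B).psat g) := by
  set P := M.product s₀ B
  refine ⟨fun ζ => ⟨rfl, P.restrict_bijective ζ⟩, fun ζ f => P.preach_eq ζ f, fun ζ f =>
    ⟨zero_le, ?_⟩, fun ζ f => P.psat_eq_one_iff ζ f, P.exists_forall_optimal⟩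
  rw [P.etotal_eq]
  exact mul_le_of_le_one_right' (P.preach_le_one ζ f)
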